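/- Let $\mathbb{k}$ be an algebraically closed field of characteristic $0$; affine varieties over $\mathbb{k}$ are reduced and irreducible. For an affine variety $X$, a one-parameter unipotent subgroup of $\mathrm{Aut}(X)$ is the image of the additive group $\mathbb{G}_a(\mathbb{k})$ under an algebraic action on $X$; $\mathrm{SAut}(X)\subseteq\mathrm{Aut}(X)$ is the subgroup generated by all of them, and $X_{\mathrm{reg}}$ is the set of smooth points of $X$. The variety $X$ is called flexible if at every $x\in X_{\mathrm{reg}}$ the tangent space $T_xX$ is spanned by the tangent vectors at $x$ to the orbits of the one-parameter unipotent subgroups of $\mathrm{Aut}(X)$. A group acting on a set acts infinitely transitively if for every $m\in\mathbb{N}$ and any two $m$-tuples of pairwise distinct points $(a_1,\dots,a_m)$, $(b_1,\dots,b_m)$ there is a group element $g$ with $g(a_i)=b_i$ for all $i$. For a nonconstant regular function $f\in\mathbb{k}[Y]$ on an affine variety $Y$, the suspension over $Y$ is $\mathrm{Susp}(Y,f)=\{uv=f(y)\}\subseteq Y\times\mathbb{A}^2$, where $u,v$ are the coordinates on $\mathbb{A}^2$. **Theorem.** Let $X^{(0)}$ be a flexible affine variety over $\mathbb{k}$.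 Assume that either $X^{(0)}\cong\mathbb{A}^1$, or $\dim X^{(0)}\ge 2$ and $\mathrm{SAut}(X^{(0)})$ acts infinitely transitively on $X^{(0)}_{\mathrm{reg}}$. Let $l\ge 1$ and let $X^{(l)}$ be an iterated suspension over $X^{(0)}$, that is, $X^{(i)}=\mathrm{Susp}(X^{(i-1)},f_i)$ for $i=1,\dots,l$, with nonconstant $f_i\in\mathbb{k}[X^{(i-1)}]$. Then $X^{(l)}$ is flexible and $\mathrm{SAut}(X^{(l)})$ acts infinitely transitively on $X^{(l)}_{\mathrm{reg}}$. -/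

import Mathlib

/-! An affine variety `X` over an algebraically closed field `k` is given by its coordinate ring
`A = k[X]`, a finitely generated `k`-algebra that is a domain. -/

namespace AffineVariety

open Polynomial

universe u v

section Notions

variable (k : Type u) [Field k] (A : Type v) [CommRing A] [Algebra k A]

/-- The (closed) points of `X`: evaluation at a point is a `k`-algebra homomorphism `k[X] → k`. -/
abbrev Point := A →ₐ[k] k

variable {k A}

/-- The Zariski tangent space `T_x X`: the `k`-valued derivations of `k[X]` at the point `x`. -/
def tangentSpace (x : Point k A) : Submodule k (A →ₗ[k] k) where
  carrier := {D | ∀ a b : A, D (a * b) = x a * D b + x b * D a}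
  add_mem' := by
    intro D E hD hE a b
    simp only [LinearMap.add_apply, hD a b, hE a b]
    ring
  zero_mem' := by
    intro a b
    simp
  smul_mem' := by
    intro c D hD a b
    simp only [LinearMap.smul_apply, smul_eq_mul, hD a b]
    ring

/-- `x ∈ X_reg`, that is, `dim T_x X = dim X` (for irreducible `X`). -/
def IsSmoothPoint (x : Point k A) : Prop :=
  (Module.finrank k (tangentSpace x) : WithBot ℕ∞) = ringKrullDim A

variable (k A)

/-- The smooth locus `X_reg`. -/
def smoothLocus : Set (Point k A) := {x | IsSmoothPoint x}

/-- An algebraic action of the additive group `G_a = (k, +)` on `X`, given by the comorphism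
`k[X] → k[X × G_a] = k[X][T]` of the action morphism `(x, t) ↦ t.x`. Thus the regular function
`coact a` on `X × G_a` is `(x, t) ↦ a (t.x)`, and the two further fields say
`0.x = x` and `s.(t.x) = (s + t).x`. -/
structure GaAction where
  coact : A →ₐ[k] A[X]
  coact_zero : ∀ a : A, (coact a).eval 0 = a
  coact_add : ∀ (s t : k) (a : A),
    (coact ((coact a).eval (algebraMap k A s))).eval (algebraMap k A t) =
      (coact a).eval (algebraMap k A (s + t))

variable {k A}

/-- The comorphism `k[X] → k[X]` of the morphism `x ↦ t.x`. -/
noncomputable def GaAction.comorphism (H : GaAction k A) (t : k) : A →ₐ[k] A :=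
  ((Polynomial.aeval (algebraMap k A t) : A[X] →ₐ[A] A).restrictScalars k).comp H.coact

theorem GaAction.comorphism_apply (H : GaAction k A) (t : k) (a : A) :
    H.comorphism t a = (H.coact a).eval (algebraMap k A t) := by
  simp [GaAction.comorphism]

theorem GaAction.comorphism_comp (H : GaAction k A) (s t : k) :
    (H.comorphism t).comp (H.comorphism s) = H.comorphism (s + t) := by
  ext a
  simp [GaAction.comorphism_apply, H.coact_add, map_add]

theorem GaAction.comorphism_zero (H : GaAction k A) : H.comorphism 0 = AlgHom.id k A := by
  ext a
  simp [GaAction.comorphism_apply, H.coact_zero]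

/-- The automorphism `x ↦ t.x` of `X`, as an automorphism of `k[X]`. -/
noncomputable def GaAction.toAut (H : GaAction k A) (t : k) : A ≃ₐ[k] A :=
  AlgEquiv.ofAlgHom (H.comorphism t) (H.comorphism (-t))
    (by rw [H.comorphism_comp, neg_add_cancel, H.comorphism_zero])
    (by rw [H.comorphism_comp, add_neg_cancel, H.comorphism_zero])

/-- The tangent vector at `x`, for `t = 0`, to the orbit `t ↦ t.x`: the derivation
`a ↦ d/dt a (t.x) |_{t = 0}`. -/
noncomputable def GaAction.tangentVector (H : GaAction k A) (x : Point k A) : tangentSpace x :=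
  ⟨{ toFun := fun a => x ((derivative (H.coact a)).eval 0)
     map_add' := by intro a b; simp
     map_smul' := by intro c a; simp }, by
    intro a b
    simp only [LinearMap.coe_mk, AddHom.coe_mk, map_mul, derivative_mul, eval_add, eval_mul,
      H.coact_zero, map_add]
    ring⟩

/-- A point is flexible if the tangent space is spanned by the tangent vectors to the orbits of
the one-parameter unipotent subgroups. -/
def IsFlexiblePoint (x : Point k A) : Prop :=
  Submodule.span k (Set.range fun H : GaAction k A => H.tangentVector x) = ⊤

variable (k A)

/-- `X` is flexible if every smooth point is. -/
def IsFlexible : Prop := ∀ x ∈ smoothLocus k A, IsFlexiblePoint x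

/-- The special automorphism group `SAut X`, generated by all one-parameter unipotent subgroups.
The group `Aut X` is written as `A ≃ₐ[k] A`, where `φ` stands for the automorphism
`x ↦ x ∘ φ⁻¹` of `X`. -/
noncomputable def SAut : Subgroup (A ≃ₐ[k] A) :=
  Subgroup.closure {φ | ∃ (H : GaAction k A) (t : k), φ = H.toAut t}

variable {k A}

/-- The action of `Aut X` on the points of `X`. -/
def act (φ : A ≃ₐ[k] A) (x : Point k A) : Point k A := x.comp (φ.symm : A →ₐ[k] A)

variable (k A)

/-- `SAut X` acts `m`-transitively on `X_reg`. -/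
def SAutIsMultiplyTransitive (m : ℕ) : Prop :=
  ∀ a b : Fin m → Point k A, Function.Injective a → Function.Injective b →
    (∀ i, a i ∈ smoothLocus k A) → (∀ i, b i ∈ smoothLocus k A) →
      ∃ g ∈ SAut k A, ∀ i, act g (a i) = b i

/-- `SAut X` acts infinitely transitively on `X_reg`. -/
def SAutIsInfinitelyTransitive : Prop := ∀ m : ℕ, SAutIsMultiplyTransitive k A m

end Notions

/-- The coordinate ring `A[u, v] / (u v - f)` of the suspension `{u v = f} ⊆ Y × 𝔸²` over the
affine variety `Y` with coordinate ring `A`. -/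
abbrev Suspension {A : Type v} [CommRing A] (f : A) : Type v :=
  MvPolynomial (Fin 2) A ⧸
    Ideal.span {(MvPolynomial.X 0 * MvPolynomial.X 1 - MvPolynomial.C f : MvPolynomial (Fin 2) A)}

/-- `IsIteratedSuspension k A l B`: the `k`-algebra `B` is the coordinate ring of an `l`-fold
iterated suspension over the variety with coordinate ring `A`. In each step the regular function
`f` is nonconstant. -/
inductive IsIteratedSuspension (k : Type u) [Field k] (A : Type v) [CommRing A] [Algebra k A] :
    ℕ → (B : Type v) → [CommRing B] → [Algebra k B] → Prop
  | zero : IsIteratedSuspension k A 0 A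
  | succ {l : ℕ} {B : Type v} [CommRing B] [Algebra k B] (f : B)
      (hf : f ∉ Set.range (algebraMap k B)) (hB : IsIteratedSuspension k A l B) :
      IsIteratedSuspension k A (l + 1) (Suspension f)

end AffineVariety

/-! The suspension `X = {u v = f(y)}` over `Y` is fibred over the line by `u` and by `v`, and each
fibre `u = c` with `c ≠ 0` is a copy of `Y`. A `G_a`-action on `Y`, run at the speed `u r(u)` for a
polynomial `r`, lifts to a `G_a`-action on `X` that preserves `u` (`Suspension.liftAction`).
Choosing `r` by interpolation, one moves the points of one fibre of `u` by a given special
automorphism of `Y` and keeps finitely many other fibres fixed (`Suspension.exists_lift_fiber`);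
the same holds for `v`.

Two properties of `Y` are used besides flexibility, and the affine line has them as well as every
`Y` with infinitely transitive `SAut Y`: that `SAut Y` is transitive on `Y_reg`, and that
two smooth points can be moved so as to separate the values of a given nonconstant function. Since
special automorphisms are joined to the identity by algebraic curves, finitely many nonvanishing
conditions that can be satisfied one at a time by special automorphisms can be satisfied at once
(`exists_forall_ne_zero`), and a nonconstant `f` takes every value on `Y_reg`
(`SAutIsTransitive.exists_smooth_apply_eq`). So `m` distinct smooth points of `X` can be moved
to have distinct nonzero coordinates `u` (`Suspension.exists_act_general_position`). Then their
coordinates `v` can be made `1, …, m` by a motion inside the fibres of `u`. Two tuples prepared in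
this way are matched by a motion inside the fibres of `v`.

For flexibility, by transitivity one smooth point is enough: where `u v ≠ 0` and `f` is not
critical, the lifts with respect to `u` and to `v` span the tangent space
(`Suspension.isFlexiblePoint`).

Points of `X` with `u = v = 0` need control of smoothness: the image in `Y` of a smooth point of `X`
is smooth, and `df ≠ 0` there if `u = v = 0` (`Suspension.smooth_proj`). This rests on
`dim X = dim Y + 1` and on `dim Y ≤ dim T_y Y`, a consequence of Nakayama's lemma, Krull's height
theorem and the equality of the heights of all maximal ideals. Generic smoothness provides smooth
points where a given nonzero function does not vanish. -/

/-! ### Dimension and smooth points of affine varieties -/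

theorem ringKrullDim_eq_of_isIntegral_of_injective {R S : Type*} [CommRing R] [CommRing S]
    [Algebra R S] [Algebra.IsIntegral R S] (hinj : Function.Injective (algebraMap R S)) :
    ringKrullDim S = ringKrullDim R := by
  have : FaithfulSMul R S := (faithfulSMul_iff_algebraMap_injective R S).mpr hinj
  apply le_antisymm
  · refine Order.krullDim_le_of_strictMono (PrimeSpectrum.comap (algebraMap R S)) ?_
    intro P Q hPQ
    exact Ideal.IsIntegral.comap_lt_comap hPQ
  · refine iSup_le fun l => ?_
    obtain ⟨P, -, hP, hPl⟩ := Ideal.exists_ideal_over_prime_of_isIntegral (S := S)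
      l.head.asIdeal ⊥ (by
        rw [← RingHom.ker_eq_comap_bot, (RingHom.injective_iff_ker_eq_bot _).mp hinj]
        exact bot_le)
    have : P.LiesOver l.head.asIdeal := ⟨hPl.symm⟩
    obtain ⟨L, hL, -⟩ := Ideal.exists_ltSeries_of_hasGoingUp (S := S) l P
    rw [← hL]
    exact le_iSup (fun p : LTSeries (PrimeSpectrum S) => (p.length : WithBot ℕ∞)) L

theorem MvPolynomial.height_eq_of_isMaximal {k : Type*} [Field k] (n : ℕ)
    (M : Ideal (MvPolynomial (Fin n) k)) [M.IsMaximal] : M.height = n := by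
  induction n with
  | zero =>
    let e := MvPolynomial.isEmptyAlgEquiv k (Fin 0)
    have hf : IsField (MvPolynomial (Fin 0) k) := e.toMulEquiv.isField (Field.toIsField k)
    let := hf.toField
    have : M = ⊥ := (Ideal.eq_bot_or_top M).resolve_right Ideal.IsPrime.ne_top'
    subst this
    simp [Ideal.height_bot]
  | succ n ih =>
    let e := (MvPolynomial.finSuccEquiv k n).toRingEquiv
    rw [← e.height_map M]
    have hM : (M.map e).IsMaximal := Ideal.map_isMaximal_of_equiv e
    let p := (M.map e).under (MvPolynomial (Fin n) k)
    have hp : p.IsMaximal := Polynomial.isMaximal_comap_C_of_isJacobsonRing (M.map e)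
    have : (M.map e).LiesOver p := ⟨rfl⟩
    rw [Polynomial.height_eq_height_add_one p (M.map e), ih p]
    norm_cast

theorem Ideal.le_height_of_integral_mvPolynomial {k A : Type*} [Field k] [CommRing A] [IsDomain A]
    [IsNoetherianRing A] (s : ℕ) [Algebra (MvPolynomial (Fin s) k) A]
    [Algebra.IsIntegral (MvPolynomial (Fin s) k) A]
    (hinj : Function.Injective (algebraMap (MvPolynomial (Fin s) k) A))
    (m : Ideal A) [m.IsMaximal] : (s : ℕ∞) ≤ m.height := by
  have : FaithfulSMul (MvPolynomial (Fin s) k) A :=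
    (faithfulSMul_iff_algebraMap_injective _ _).mpr hinj
  have hp : (m.under (MvPolynomial (Fin s) k)).IsMaximal :=
    Ideal.isMaximal_comap_of_isIntegral_of_isMaximal m
  have : m.LiesOver (m.under (MvPolynomial (Fin s) k)) := ⟨rfl⟩
  rw [Ideal.height_eq_height_add_of_liesOver_of_hasGoingDown (m.under (MvPolynomial (Fin s) k)) m,
    MvPolynomial.height_eq_of_isMaximal]
  exact le_self_add

/-- Noether normalization, together with the dimension of the polynomial ring it produces. -/
theorem exists_integral_mvPolynomial_ringKrullDim_eq (k A : Type*) [Field k] [CommRing A]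
    [IsDomain A] [Algebra k A] [Algebra.FiniteType k A] :
    ∃ (s : ℕ) (g : MvPolynomial (Fin s) k →ₐ[k] A), Function.Injective g ∧
      g.toRingHom.IsIntegral ∧ ringKrullDim A = s := by
  obtain ⟨s, g, hg, hint⟩ := exists_integral_inj_algHom_of_fg k A
  refine ⟨s, g, hg, hint, ?_⟩
  let := g.toRingHom.toAlgebra
  have : Algebra.IsIntegral (MvPolynomial (Fin s) k) A := ⟨hint⟩
  rw [ringKrullDim_eq_of_isIntegral_of_injective (R := MvPolynomial (Fin s) k) (S := A) hg,
    MvPolynomial.ringKrullDim_of_isNoetherianRing]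
  simp

theorem Ideal.ringKrullDim_le_height_of_isMaximal (k : Type*) {A : Type*} [Field k] [CommRing A]
    [IsDomain A] [Algebra k A] [Algebra.FiniteType k A] (m : Ideal A) [m.IsMaximal] :
    ringKrullDim A ≤ m.height := by
  have := Algebra.FiniteType.isNoetherianRing k A
  obtain ⟨s, g, hg, hint, hs⟩ := exists_integral_mvPolynomial_ringKrullDim_eq k A
  let := g.toRingHom.toAlgebra
  have : Algebra.IsIntegral (MvPolynomial (Fin s) k) A := ⟨hint⟩
  rw [hs]
  exact_mod_cast Ideal.le_height_of_integral_mvPolynomial (k := k) s hg m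

namespace AffineVariety

open Polynomial

section Points

variable {k : Type*} [Field k] {A : Type*} [CommRing A] [Algebra k A]

theorem Point.surjective (x : Point k A) : Function.Surjective x := fun c =>
  ⟨algebraMap k A c, by simp⟩

theorem Point.ker_isMaximal (x : Point k A) : (RingHom.ker x).IsMaximal :=
  RingHom.ker_isMaximal_of_surjective x x.surjective

/-- A nonzero regular function on an affine variety is nonzero at some point. -/
theorem exists_point_apply_ne_zero [IsAlgClosed k] [IsDomain A] [Algebra.FiniteType k A]
    {g : A} (hg : g ≠ 0) : ∃ x : Point k A, x g ≠ 0 := by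
  let L := Localization.Away g
  have : Nontrivial L :=
    (IsLocalization.injective L (powers_le_nonZeroDivisors_of_noZeroDivisors hg)).nontrivial
  obtain ⟨M, hM⟩ := Ideal.exists_maximal L
  let := Ideal.Quotient.field M
  have : Algebra.FiniteType A L := IsLocalization.finiteType_of_monoid_fg (.powers g) L
  have : Algebra.FiniteType k L := .trans (S := A) inferInstance inferInstance
  have : Algebra.FiniteType k (L ⧸ M) :=
    .of_surjective (Ideal.Quotient.mkₐ k M) Ideal.Quotient.mk_surjective
  have : Module.Finite k (L ⧸ M) := finite_of_finite_type_of_isJacobsonRing k (L ⧸ M)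
  let φ : (L ⧸ M) →ₐ[k] k := IsAlgClosed.lift
  let ψ : A →ₐ[k] L := IsScalarTower.toAlgHom k A L
  refine ⟨(φ.comp (Ideal.Quotient.mkₐ k M)).comp ψ, ?_⟩
  have hu : IsUnit (ψ g) := IsLocalization.Away.algebraMap_isUnit g
  exact (hu.map ((φ.comp (Ideal.Quotient.mkₐ k M)))).ne_zero

theorem eq_of_forall_point [IsAlgClosed k] [IsDomain A] [Algebra.FiniteType k A]
    {a b : A} (h : ∀ x : Point k A, x a = x b) : a = b := by
  by_contra hab
  obtain ⟨x, hx⟩ := exists_point_apply_ne_zero (k := k) (sub_ne_zero.mpr hab)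
  exact hx (by simp [h x])

theorem tangentSpace_apply_mul {x : Point k A} (D : tangentSpace x) (a b : A) :
    D.1 (a * b) = x a * D.1 b + x b * D.1 a := D.2 a b

theorem tangentSpace_apply_one {x : Point k A} (D : tangentSpace x) : D.1 1 = 0 := by
  have := tangentSpace_apply_mul D 1 1
  simpa using this

theorem tangentSpace_apply_algebraMap {x : Point k A} (D : tangentSpace x) (c : k) :
    D.1 (algebraMap k A c) = 0 := by
  rw [Algebra.algebraMap_eq_smul_one, map_smul, tangentSpace_apply_one, smul_zero]

/-- A tangent vector vanishing on a set of functions vanishes on the subalgebra it generates. -/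
theorem tangentSpace_apply_eq_zero_of_mem_adjoin {x : Point k A} (D : tangentSpace x) {S : Set A}
    (hS : ∀ a ∈ S, D.1 a = 0) {a : A} (ha : a ∈ Algebra.adjoin k S) : D.1 a = 0 := by
  induction ha using Algebra.adjoin_induction with
  | mem a ha => exact hS a ha
  | algebraMap c => exact tangentSpace_apply_algebraMap D c
  | add a b _ _ ha hb => rw [map_add, ha, hb, add_zero]
  | mul a b _ _ ha hb => rw [tangentSpace_apply_mul, ha, hb]; simp

/-- The chain rule for a polynomial with coefficients that a tangent vector kills. -/
theorem tangentSpace_apply_eval₂ {R : Type*} [CommRing R] (φ : R →+* A) {x : Point k A}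
    (D : tangentSpace x) (hD : ∀ r, D.1 (φ r) = 0) (p : R[X]) (a : A) :
    D.1 (p.eval₂ φ a) = x (p.derivative.eval₂ φ a) * D.1 a := by
  induction p using Polynomial.induction_on' with
  | add p q hp hq => simp only [eval₂_add, map_add, hp, hq]; ring
  | monomial n r =>
    have hpow : ∀ n : ℕ, D.1 (a ^ n) = n * x a ^ (n - 1) * D.1 a := by
      intro n
      induction n with
      | zero => simp [tangentSpace_apply_one]
      | succ n ih =>
        rw [pow_succ, tangentSpace_apply_mul, ih]
        rcases n with _ | n
        · simp
        · simp; ring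
    rw [derivative_monomial, eval₂_monomial, eval₂_monomial, tangentSpace_apply_mul, hpow, hD]
    simp
    ring

instance [Algebra.FiniteType k A] (x : Point k A) : FiniteDimensional k (tangentSpace x) := by
  obtain ⟨S, hS⟩ := Algebra.FiniteType.out (R := k) (A := A)
  let ev : tangentSpace x →ₗ[k] (S → k) :=
    { toFun := fun D a => D.1 a
      map_add' := fun _ _ => rfl
      map_smul' := fun _ _ => rfl }
  refine FiniteDimensional.of_injective ev ?_
  rw [injective_iff_map_eq_zero]
  intro D hD
  ext a
  exact tangentSpace_apply_eq_zero_of_mem_adjoin D (S := S)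
    (fun a ha => congrFun hD ⟨a, ha⟩) (hS ▸ Algebra.mem_top)

/-- The subspace of functions `c + h` with `c` constant and `h` vanishing to second order at `x`. -/
def constAddSq (x : Point k A) : Submodule k A :=
  k ∙ (1 : A) ⊔ ((RingHom.ker x) ^ 2).restrictScalars k

theorem mem_tangentSpace_iff (x : Point k A) (D : A →ₗ[k] k) :
    D ∈ tangentSpace x ↔ D ∈ (constAddSq x).dualAnnihilator := by
  rw [Submodule.mem_dualAnnihilator]
  constructor
  · intro hD a ha
    obtain ⟨b, hb, c, hc, rfl⟩ := Submodule.mem_sup.mp ha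
    obtain ⟨t, rfl⟩ := Submodule.mem_span_singleton.mp hb
    have h1 : D 1 = 0 := tangentSpace_apply_one ⟨D, hD⟩
    have h2 : D c = 0 := by
      rw [Submodule.restrictScalars_mem, pow_two] at hc
      refine Submodule.mul_induction_on hc ?_ ?_
      · intro p hp q hq
        rw [RingHom.mem_ker] at hp hq
        rw [hD p q]
        erw [hp, hq]
        simp
      · intro p q hp hq
        rw [map_add, hp, hq, add_zero]
    simp [h1, h2]
  · intro h a b
    have h1 : D 1 = 0 := h 1 (Submodule.mem_sup_left (Submodule.mem_span_singleton_self 1))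
    have h2 : D ((a - algebraMap k A (x a)) * (b - algebraMap k A (x b))) = 0 := by
      refine h _ (Submodule.mem_sup_right ?_)
      rw [Submodule.restrictScalars_mem, pow_two]
      exact Ideal.mul_mem_mul (by simp [RingHom.mem_ker]) (by simp [RingHom.mem_ker])
    have h3 : (a - algebraMap k A (x a)) * (b - algebraMap k A (x b)) =
        a * b - x a • b - x b • a + (x a * x b) • (1 : A) := by
      simp only [Algebra.smul_def, map_mul]; ring
    rw [h3] at h2
    simp only [map_add, map_sub, map_smul, smul_eq_mul, h1] at h2
    linear_combination h2

theorem finrank_tangentSpace (x : Point k A) :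
    Module.finrank k (tangentSpace x) = Module.finrank k (A ⧸ constAddSq x) := by
  have h : tangentSpace x = (constAddSq x).dualAnnihilator := by
    ext D; exact mem_tangentSpace_iff x D
  rw [h, ← (constAddSq x).dualQuotEquivDualAnnihilator.finrank_eq]
  exact Subspace.dual_finrank_eq

/-- The dimension of a variety is at most that of each Zariski tangent space. By Nakayama's lemma,
functions giving a basis of the cotangent space generate the maximal ideal up to a factor that does
not vanish at the point, so Krull's height theorem applies. -/
theorem ringKrullDim_le_finrank_tangentSpace [IsDomain A] [Algebra.FiniteType k A]
    (x : Point k A) : ringKrullDim A ≤ (Module.finrank k (tangentSpace x) : WithBot ℕ∞) := by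
  classical
  have := Algebra.FiniteType.isNoetherianRing k A
  have hmax := x.ker_isMaximal
  set m := RingHom.ker x with hm
  have hm_mem : ∀ a, a ∈ m ↔ x a = 0 := fun a => Iff.rfl
  have hfin : FiniteDimensional k (A ⧸ constAddSq x) := by
    have h : tangentSpace x = (constAddSq x).dualAnnihilator := by
      ext D; exact mem_tangentSpace_iff x D
    exact Submodule.finite_dualAnnihilator_iff.mp (h ▸ inferInstance)
  let b := Module.finBasis k (A ⧸ constAddSq x)
  choose g hg using fun i => Submodule.mkQ_surjective (constAddSq x) (b i)
  let g' : Fin _ → A := fun i => g i - algebraMap k A (x (g i))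
  let T : Finset A := Finset.univ.image g'
  have hg' : ∀ i, x (g' i) = 0 := fun i => by simp [g']
  have hT : m ≤ Ideal.span (T : Set A) ⊔ m • m := by
    intro a ha
    have h1 := b.sum_repr ((constAddSq x).mkQ a)
    have h2 : a - ∑ i, b.repr ((constAddSq x).mkQ a) i • g' i ∈ constAddSq x := by
      rw [← Submodule.Quotient.mk_eq_zero, ← Submodule.mkQ_apply, map_sub, map_sum, sub_eq_zero]
      conv_lhs => rw [← h1]
      refine Finset.sum_congr rfl fun i _ => ?_
      rw [map_smul]
      congr 1
      simp only [g', map_sub, hg]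
      rw [eq_comm, sub_eq_self, Submodule.mkQ_apply, Submodule.Quotient.mk_eq_zero,
        Algebra.algebraMap_eq_smul_one]
      exact Submodule.smul_mem _ _ (Submodule.mem_sup_left (Submodule.mem_span_singleton_self 1))
    obtain ⟨p, hp, q, hq, hpq⟩ := Submodule.mem_sup.mp h2
    obtain ⟨c, rfl⟩ := Submodule.mem_span_singleton.mp hp
    rw [Submodule.restrictScalars_mem, pow_two] at hq
    have hq0 : x q = 0 := (Ideal.mul_le_left hq : q ∈ m)
    have hc : c = 0 := by
      have := congrArg x hpq
      simpa [hq0, hg', (hm_mem a).mp ha] using this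
    have ha' : a = ∑ i, b.repr ((constAddSq x).mkQ a) i • g' i + q := by
      rw [hc, zero_smul, zero_add] at hpq
      rw [hpq]; ring
    rw [ha']
    refine Submodule.add_mem_sup (Submodule.sum_mem _ fun i _ => ?_) hq
    rw [Algebra.smul_def]
    exact Ideal.mul_mem_left _ _ (Ideal.subset_span (by simp [T]))
  obtain ⟨r, hr, hrm⟩ := Submodule.exists_sub_one_mem_and_smul_le_of_fg_of_le_sup
    (IsNoetherian.noetherian m) le_rfl hT
  have hr0 : r ∉ m := by
    intro h
    have : (1 : A) ∈ m := by simpa using m.sub_mem h hr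
    exact hmax.ne_top ((Ideal.eq_top_iff_one m).mpr this)
  have hmin : m ∈ (Ideal.span (T : Set A)).minimalPrimes := by
    refine ⟨⟨hmax.isPrime, ?_⟩, ?_⟩
    · rw [Ideal.span_le]
      intro a ha
      simp only [T, Finset.coe_image, Finset.coe_univ, Set.image_univ, Set.mem_range] at ha
      obtain ⟨i, rfl⟩ := ha
      exact hg' i
    · rintro q ⟨hq, hTq⟩ hqm a ha
      have : r * a ∈ q := hTq (hrm (Submodule.smul_mem_pointwise_smul a r m ha))
      exact (hq.mem_or_mem this).resolve_left fun h => hr0 (hqm h)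
  calc ringKrullDim A ≤ m.height := Ideal.ringKrullDim_le_height_of_isMaximal k m
    _ ≤ ((T.card : ℕ∞) : WithBot ℕ∞) :=
      WithBot.coe_le_coe.mpr (Ideal.height_le_card_of_mem_minimalPrimes_span_finset hmin)
    _ ≤ _ := by
      rw [finrank_tangentSpace]
      have : T.card ≤ Module.finrank k (A ⧸ constAddSq x) := by
        simpa using Finset.card_image_le (s := Finset.univ) (f := g')
      exact_mod_cast this

/-- Generic smoothness in characteristic zero: the smooth points are dense. Over a Noether
normalization `k[x₁, …, x_s] → A` each generator `a` of `A` satisfies a polynomial `p` of minimal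
degree; where all the functions `p' (a)` are nonzero, a tangent vector is determined by its values
on the `x_i`. -/
theorem exists_mem_smoothLocus_apply_ne_zero [IsAlgClosed k] [CharZero k] [IsDomain A]
    [Algebra.FiniteType k A] {g : A} (hg : g ≠ 0) : ∃ x ∈ smoothLocus k A, x g ≠ 0 := by
  classical
  obtain ⟨s, φ, hφ, hint, hs⟩ := exists_integral_mvPolynomial_ringKrullDim_eq k A
  have hsep : ∀ a : A, ∃ p : (MvPolynomial (Fin s) k)[X], p.eval₂ φ.toRingHom a = 0 ∧
      p.derivative.eval₂ φ.toRingHom a ≠ 0 := by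
    intro a
    obtain ⟨p, hp, hpa⟩ := hint a
    have hex : ∃ n, ∃ p : (MvPolynomial (Fin s) k)[X], p ≠ 0 ∧ p.eval₂ φ.toRingHom a = 0 ∧
        p.natDegree = n := ⟨_, p, hp.ne_zero, hpa, rfl⟩
    obtain ⟨q, hq0, hqa, hqn⟩ := Nat.find_spec hex
    refine ⟨q, hqa, fun hder => ?_⟩
    have hdeg : q.natDegree ≠ 0 := by
      intro h0
      rw [natDegree_eq_zero] at h0
      obtain ⟨c, rfl⟩ := h0
      rw [eval₂_C] at hqa
      exact hq0 (by rw [(map_eq_zero_iff φ.toRingHom hφ).mp hqa, C_0])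
    have hder0 : q.derivative ≠ 0 := fun h0 => hdeg (derivative_eq_zero.mp h0)
    exact Nat.find_min hex (hqn ▸ natDegree_derivative_lt hdeg) ⟨_, hder0, hder, rfl⟩
  choose p hp hp' using hsep
  obtain ⟨S, hS⟩ := Algebra.FiniteType.out (R := k) (A := A)
  have hne : g * ∏ a ∈ S, (p a).derivative.eval₂ φ.toRingHom a ≠ 0 :=
    mul_ne_zero hg (Finset.prod_ne_zero_iff.mpr fun a _ => hp' a)
  obtain ⟨x, hx⟩ := exists_point_apply_ne_zero (k := k) hne
  rw [map_mul, map_prod] at hx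
  refine ⟨x, ?_, left_ne_zero_of_mul hx⟩
  have hx' := Finset.prod_ne_zero_iff.mp (right_ne_zero_of_mul hx)
  let ev : tangentSpace x →ₗ[k] (Fin s → k) :=
    { toFun := fun D i => D.1 (φ (MvPolynomial.X i))
      map_add' := fun _ _ => rfl
      map_smul' := fun _ _ => rfl }
  have hev : Function.Injective ev := by
    rw [injective_iff_map_eq_zero]
    intro D hD
    have hD0 : ∀ r, D.1 (φ r) = 0 := by
      intro r
      refine tangentSpace_apply_eq_zero_of_mem_adjoin D
        (S := Set.range fun i => φ (MvPolynomial.X i)) ?_ ?_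
      · rintro _ ⟨i, rfl⟩
        exact congrFun hD i
      · have : φ r ∈ (Algebra.adjoin k (Set.range MvPolynomial.X)).map φ :=
          ⟨r, by simp [MvPolynomial.adjoin_range_X], rfl⟩
        rwa [AlgHom.map_adjoin, ← Set.range_comp] at this
    ext a
    refine tangentSpace_apply_eq_zero_of_mem_adjoin D (S := S) (fun a ha => ?_)
      (hS ▸ Algebra.mem_top)
    have h := tangentSpace_apply_eval₂ φ.toRingHom D hD0 (p a) a
    rw [hp a, map_zero] at h
    exact (mul_eq_zero.mp h.symm).resolve_left (hx' a ha)
  refine le_antisymm ?_ (ringKrullDim_le_finrank_tangentSpace x)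
  rw [hs]
  have := LinearMap.finrank_le_finrank_of_injective hev
  rw [Module.finrank_fin_fun] at this
  exact_mod_cast this

end Points

end AffineVariety

/-! ### Special automorphisms and algebraic curves of automorphisms -/

namespace AffineVariety

open Polynomial

section Action

variable {k : Type*} [Field k] {A : Type*} [CommRing A] [Algebra k A]

theorem act_apply (φ : A ≃ₐ[k] A) (x : Point k A) (a : A) : act φ x a = x (φ.symm a) := rfl

theorem act_one (x : Point k A) : act 1 x = x := rfl

theorem act_mul (φ ψ : A ≃ₐ[k] A) (x : Point k A) : act (φ * ψ) x = act φ (act ψ x) := rfl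

theorem act_inv_act (φ : A ≃ₐ[k] A) (x : Point k A) : act φ⁻¹ (act φ x) = x := by
  rw [← act_mul, inv_mul_cancel, act_one]

theorem act_act_inv (φ : A ≃ₐ[k] A) (x : Point k A) : act φ (act φ⁻¹ x) = x := by
  rw [← act_mul, mul_inv_cancel, act_one]

theorem act_injective (φ : A ≃ₐ[k] A) : Function.Injective (act (k := k) φ) :=
  Function.LeftInverse.injective (act_inv_act φ)

theorem GaAction.toAut_symm_apply (H : GaAction k A) (t : k) (a : A) :
    (H.toAut t).symm a = H.comorphism (-t) a := rfl

theorem GaAction.toAut_inv (H : GaAction k A) (t : k) : (H.toAut t)⁻¹ = H.toAut (-t) := by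
  ext a
  change H.comorphism (-t) a = _
  rfl

theorem GaAction.toAut_mem_SAut (H : GaAction k A) (t : k) : H.toAut t ∈ SAut k A :=
  Subgroup.subset_closure ⟨H, t, rfl⟩

/-- Induction over the special automorphism group. -/
theorem SAut_induction {p : (A ≃ₐ[k] A) → Prop} (hone : p 1)
    (hga : ∀ (H : GaAction k A) (t : k), p (H.toAut t))
    (hmul : ∀ g h, p g → p h → p (g * h)) {g : A ≃ₐ[k] A} (hg : g ∈ SAut k A) : p g := by
  induction hg using Subgroup.closure_induction'' with
  | one => exact hone
  | mem g hg => obtain ⟨H, t, rfl⟩ := hg; exact hga H t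
  | inv_mem g hg => obtain ⟨H, t, rfl⟩ := hg; rw [H.toAut_inv]; exact hga H (-t)
  | mul g h _ _ hg hh => exact hmul g h hg hh

/-- The differential of an automorphism at a point. -/
def tangentSpaceEquiv (φ : A ≃ₐ[k] A) (x : Point k A) :
    tangentSpace x ≃ₗ[k] tangentSpace (act φ x) where
  toFun D := ⟨D.1.comp φ.symm.toLinearMap, fun a b => by simp [tangentSpace_apply_mul, act_apply]⟩
  invFun D := ⟨D.1.comp φ.toLinearMap, fun a b => by simp [tangentSpace_apply_mul, act_apply]⟩
  map_add' _ _ := rfl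
  map_smul' _ _ := rfl
  left_inv D := by ext a; simp
  right_inv D := by ext a; simp

theorem act_mem_smoothLocus (φ : A ≃ₐ[k] A) {x : Point k A} (hx : x ∈ smoothLocus k A) :
    act φ x ∈ smoothLocus k A := by
  have := (tangentSpaceEquiv φ x).finrank_eq
  change (Module.finrank k (tangentSpace (act φ x)) : WithBot ℕ∞) = ringKrullDim A
  rw [← this]
  exact hx

/-- Transport of a `G_a`-action along an isomorphism of varieties. -/
noncomputable def GaAction.congr {B : Type*} [CommRing B] [Algebra k B] (e : A ≃ₐ[k] B)
    (H : GaAction k A) : GaAction k B where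
  coact := (mapAlgHom (e : A →ₐ[k] B)).comp (H.coact.comp (e.symm : B →ₐ[k] A))
  coact_zero b := by
    have h : (0 : B) = (e : A →+* B) 0 := by simp
    simp only [AlgHom.comp_apply, coe_mapAlgHom]
    erw [h, eval_map_apply, H.coact_zero]
    simp
  coact_add s t b := by
    have h : ∀ (t : k) (p : A[X]), (p.map (e : A →+* B)).eval (algebraMap k B t) =
        e (p.eval (algebraMap k A t)) := by
      intro t p
      have : algebraMap k B t = (e : A →+* B) (algebraMap k A t) := by simp
      rw [this, eval_map_apply]
      simp
    simp only [AlgHom.comp_apply, coe_mapAlgHom]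
    erw [h, h, h]
    simp [H.coact_add]

theorem GaAction.congr_comorphism {B : Type*} [CommRing B] [Algebra k B] (e : A ≃ₐ[k] B)
    (H : GaAction k A) (t : k) (b : B) :
    (H.congr e).comorphism t b = e (H.comorphism t (e.symm b)) := by
  rw [GaAction.comorphism_apply, GaAction.comorphism_apply]
  have : algebraMap k B t = (e : A →+* B) (algebraMap k A t) := by simp
  simp only [GaAction.congr, AlgHom.comp_apply, coe_mapAlgHom]
  rw [this]
  erw [eval_map_apply]
  simp

/-- Transport of an automorphism along an isomorphism of varieties. -/
def conjAut {B : Type*} [CommRing B] [Algebra k B] (e : A ≃ₐ[k] B) (g : A ≃ₐ[k] A) : B ≃ₐ[k] B :=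
  (e.symm.trans g).trans e

theorem conjAut_mem_SAut {B : Type*} [CommRing B] [Algebra k B] (e : A ≃ₐ[k] B) {g : A ≃ₐ[k] A}
    (hg : g ∈ SAut k A) : conjAut e g ∈ SAut k B := by
  refine SAut_induction (p := fun g => conjAut e g ∈ SAut k B) ?_ ?_ ?_ hg
  · have : conjAut e (1 : A ≃ₐ[k] A) = 1 := by ext b; simp [conjAut]
    rw [this]; exact one_mem _
  · intro H t
    have : conjAut e (H.toAut t) = (H.congr e).toAut t := by
      ext b
      exact (H.congr_comorphism e t b).symm
    rw [this]; exact GaAction.toAut_mem_SAut _ _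
  · intro g h hg hh
    have : conjAut e (g * h) = conjAut e g * conjAut e h := by ext b; simp [conjAut]
    rw [this]; exact mul_mem hg hh

end Action

section Curves

variable {k : Type*} [Field k] {A : Type*} [CommRing A] [Algebra k A]

/-- A family of automorphisms `γ t` is algebraic in `t ∈ 𝔸¹` if each `a ((γ t)⁻¹ x)` is a
polynomial in `t` with coefficients regular functions of `x`. Here the automorphism
of `X` given by `γ t` acts on functions through `(γ t).symm`. -/
def IsAlgebraicCurve (γ : k → (A ≃ₐ[k] A)) : Prop :=
  ∀ a : A, ∃ F : A[X], ∀ t, (γ t).symm a = F.eval (algebraMap k A t)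

theorem isAlgebraicCurve_const (g : A ≃ₐ[k] A) : IsAlgebraicCurve fun _ : k => g :=
  fun a => ⟨C (g.symm a), fun t => by simp⟩

theorem IsAlgebraicCurve.mul {γ δ : k → (A ≃ₐ[k] A)} (hγ : IsAlgebraicCurve γ)
    (hδ : IsAlgebraicCurve δ) : IsAlgebraicCurve fun t => γ t * δ t := by
  intro a
  obtain ⟨F, hF⟩ := hγ a
  choose G hG using hδ
  refine ⟨∑ i ∈ Finset.range (F.natDegree + 1), G (F.coeff i) * X ^ i, fun t => ?_⟩
  change (δ t).symm ((γ t).symm a) = _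
  rw [hF, eval_eq_sum_range, map_sum, eval_finsetSum]
  refine Finset.sum_congr rfl fun i _ => ?_
  rw [map_mul, hG, map_pow, AlgEquiv.commutes]
  simp

theorem GaAction.isAlgebraicCurve (H : GaAction k A) (c : k) :
    IsAlgebraicCurve fun t => H.toAut (t * c) := by
  intro a
  refine ⟨(H.coact a).comp (-(C (algebraMap k A c) * X)), fun t => ?_⟩
  rw [GaAction.toAut_symm_apply, GaAction.comorphism_apply]
  rw [eval_comp, eval_neg, eval_mul, eval_C, eval_X, ← map_mul, ← map_neg, mul_comm]

/-- Special automorphisms are connected to the identity by algebraic curves. -/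
theorem exists_isAlgebraicCurve {g : A ≃ₐ[k] A} (hg : g ∈ SAut k A) :
    ∃ γ : k → (A ≃ₐ[k] A), IsAlgebraicCurve γ ∧ (∀ t, γ t ∈ SAut k A) ∧ γ 0 = 1 ∧ γ 1 = g := by
  refine SAut_induction (p := fun g => ∃ γ : k → (A ≃ₐ[k] A), IsAlgebraicCurve γ ∧
    (∀ t, γ t ∈ SAut k A) ∧ γ 0 = 1 ∧ γ 1 = g) ?_ ?_ ?_ hg
  · exact ⟨fun _ => 1, isAlgebraicCurve_const 1, fun _ => one_mem _, rfl, rfl⟩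
  · intro H c
    refine ⟨fun t => H.toAut (t * c), H.isAlgebraicCurve c, fun _ => H.toAut_mem_SAut _, ?_, ?_⟩
    · ext a
      change H.comorphism (0 * c) a = a
      rw [zero_mul, H.comorphism_zero]
      rfl
    · simp
  · rintro g h ⟨γ, h1, h2, h3, h4⟩ ⟨δ, h1', h2', h3', h4'⟩
    exact ⟨fun t => γ t * δ t, h1.mul h1', fun t => mul_mem (h2 t) (h2' t), by simp [h3, h3'],
      by simp [h4, h4']⟩

/-- A function on automorphisms is algebraic if it is polynomial along algebraic curves. -/
def IsAlgebraicFunction (c : (A ≃ₐ[k] A) → k) : Prop :=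
  ∀ γ : k → (A ≃ₐ[k] A), IsAlgebraicCurve γ → ∃ F : k[X], ∀ t, c (γ t) = F.eval t

theorem isAlgebraicFunction_act (x : Point k A) (a : A) :
    IsAlgebraicFunction fun g => act g x a := by
  intro γ hγ
  obtain ⟨F, hF⟩ := hγ a
  refine ⟨F.map (x : A →+* k), fun t => ?_⟩
  change x ((γ t).symm a) = _
  rw [hF]
  have := eval_map_apply (f := (x : A →+* k)) (p := F) (algebraMap k A t)
  simpa using this.symm

theorem IsAlgebraicFunction.sub {c d : (A ≃ₐ[k] A) → k} (hc : IsAlgebraicFunction c)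
    (hd : IsAlgebraicFunction d) : IsAlgebraicFunction fun g => c g - d g := by
  intro γ hγ
  obtain ⟨F, hF⟩ := hc γ hγ
  obtain ⟨G, hG⟩ := hd γ hγ
  exact ⟨F - G, fun t => by simp [hF, hG]⟩

theorem IsAlgebraicFunction.mul {c d : (A ≃ₐ[k] A) → k} (hc : IsAlgebraicFunction c)
    (hd : IsAlgebraicFunction d) : IsAlgebraicFunction fun g => c g * d g := by
  intro γ hγ
  obtain ⟨F, hF⟩ := hc γ hγ
  obtain ⟨G, hG⟩ := hd γ hγ
  exact ⟨F * G, fun t => by simp [hF, hG]⟩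

theorem isAlgebraicFunction_prod {ι : Type*} (s : Finset ι) {c : ι → (A ≃ₐ[k] A) → k}
    (hc : ∀ i ∈ s, IsAlgebraicFunction (c i)) : IsAlgebraicFunction fun g => ∏ i ∈ s, c i g := by
  intro γ hγ
  have h : ∀ i, ∃ F : k[X], i ∈ s → ∀ t, c i (γ t) = F.eval t := fun i => by
    by_cases hi : i ∈ s
    · obtain ⟨F, hF⟩ := hc i hi γ hγ
      exact ⟨F, fun _ => hF⟩
    · exact ⟨0, fun h => absurd h hi⟩
  choose F hF using h
  refine ⟨∏ i ∈ s, F i, fun t => ?_⟩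
  rw [eval_prod]
  exact Finset.prod_congr rfl fun i hi => hF i hi t

/-- `SAut` behaves like an irreducible variety: two algebraic functions that do not vanish
identically on it have a common non-zero. -/
theorem exists_common_ne_zero [Infinite k] {c d : (A ≃ₐ[k] A) → k} (hc : IsAlgebraicFunction c)
    (hd : IsAlgebraicFunction d) (hc' : ∃ g ∈ SAut k A, c g ≠ 0) (hd' : ∃ g ∈ SAut k A, d g ≠ 0) :
    ∃ g ∈ SAut k A, c g ≠ 0 ∧ d g ≠ 0 := by
  obtain ⟨g, hg, hcg⟩ := hc'
  obtain ⟨h, hh, hdh⟩ := hd'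
  obtain ⟨γ, hγ, hγm, hγ0, hγ1⟩ := exists_isAlgebraicCurve (mul_mem hh (inv_mem hg))
  obtain ⟨F, hF⟩ := hc _ (hγ.mul (isAlgebraicCurve_const g))
  obtain ⟨G, hG⟩ := hd _ (hγ.mul (isAlgebraicCurve_const g))
  have hF0 : F ≠ 0 := by
    rintro rfl
    have := hF 0
    rw [hγ0, one_mul, eval_zero] at this
    exact hcg this
  have hG0 : G ≠ 0 := by
    rintro rfl
    have := hG 1
    rw [hγ1, inv_mul_cancel_right, eval_zero] at this
    exact hdh this
  obtain ⟨t, ht⟩ : ∃ t, (F * G).eval t ≠ 0 := by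
    by_contra! h
    exact mul_ne_zero hF0 hG0 (Polynomial.funext fun t => by simp [h t])
  rw [eval_mul, ← hF, ← hG] at ht
  exact ⟨_, mul_mem (hγm t) hg, left_ne_zero_of_mul ht, right_ne_zero_of_mul ht⟩

theorem exists_forall_ne_zero [Infinite k] {ι : Type*} (s : Finset ι) {c : ι → (A ≃ₐ[k] A) → k}
    (hc : ∀ i ∈ s, IsAlgebraicFunction (c i)) (hc' : ∀ i ∈ s, ∃ g ∈ SAut k A, c i g ≠ 0) :
    ∃ g ∈ SAut k A, ∀ i ∈ s, c i g ≠ 0 := by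
  classical
  suffices h : ∃ g ∈ SAut k A, ∏ i ∈ s, c i g ≠ 0 by
    obtain ⟨g, hg, h⟩ := h
    exact ⟨g, hg, Finset.prod_ne_zero_iff.mp h⟩
  induction s using Finset.induction_on with
  | empty => exact ⟨1, one_mem _, by simp⟩
  | insert i s hi ih =>
    simp only [Finset.prod_insert hi]
    obtain ⟨g, hg, h1, h2⟩ := exists_common_ne_zero (hc i (by simp))
      (isAlgebraicFunction_prod s fun j hj => hc j (by simp [hj])) (hc' i (by simp))
      (ih (fun j hj => hc j (by simp [hj])) (fun j hj => hc' j (by simp [hj])))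
    exact ⟨g, hg, mul_ne_zero h1 h2⟩

/-- `SAut X` is transitive on `X_reg`. -/
def SAutIsTransitive (k : Type*) [Field k] (A : Type*) [CommRing A] [Algebra k A] : Prop :=
  ∀ x ∈ smoothLocus k A, ∀ y ∈ smoothLocus k A, ∃ g ∈ SAut k A, act g x = y

theorem SAutIsInfinitelyTransitive.transitive (hA : SAutIsInfinitelyTransitive k A) :
    SAutIsTransitive k A := by
  intro x hx y hy
  obtain ⟨g, hg, h⟩ := hA 1 (fun _ => x) (fun _ => y) (Function.injective_of_subsingleton _)
    (Function.injective_of_subsingleton _) (fun _ => hx) (fun _ => hy)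
  exact ⟨g, hg, h 0⟩

variable [IsAlgClosed k] [CharZero k] [IsDomain A] [Algebra.FiniteType k A]

theorem exists_smooth_ne {f : A} (hf : f ∉ Set.range (algebraMap k A)) :
    ∃ x ∈ smoothLocus k A, ∃ y ∈ smoothLocus k A, x f ≠ y f := by
  obtain ⟨x, hx, -⟩ := exists_mem_smoothLocus_apply_ne_zero (k := k) (one_ne_zero (α := A))
  have : f - algebraMap k A (x f) ≠ 0 := fun h => hf ⟨x f, (sub_eq_zero.mp h).symm⟩
  obtain ⟨y, hy, hxy⟩ := exists_mem_smoothLocus_apply_ne_zero (k := k) this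
  refine ⟨x, hx, y, hy, fun h => hxy ?_⟩
  simp [h]

/-- A nonconstant function takes all values on the smooth locus if `SAut` is transitive there: it is
a nonconstant polynomial along some algebraic curve of automorphisms. -/
theorem SAutIsTransitive.exists_smooth_apply_eq (hA : SAutIsTransitive k A) {f : A}
    (hf : f ∉ Set.range (algebraMap k A)) (c : k) : ∃ x ∈ smoothLocus k A, x f = c := by
  obtain ⟨x, hx, y, hy, hxy⟩ := exists_smooth_ne (k := k) hf
  obtain ⟨g, hg, hgx⟩ := hA x hx y hy
  obtain ⟨γ, hγ, hγm, hγ0, hγ1⟩ := exists_isAlgebraicCurve hg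
  obtain ⟨F, hF⟩ : ∃ F : k[X], ∀ t, act (γ t) x f = F.eval t := isAlgebraicFunction_act x f γ hγ
  have hdeg : (F - C c).degree ≠ 0 := by
    intro h
    obtain ⟨d, hd⟩ : ∃ d, F - C c = C d := ⟨_, eq_C_of_degree_eq_zero h⟩
    have hFd : ∀ t, act (γ t) x f = d + c := fun t => by
      rw [hF, sub_eq_iff_eq_add.mp hd]; simp
    have h0 := hFd 0
    have h1 := hFd 1
    rw [hγ0, act_one] at h0
    rw [hγ1, hgx] at h1
    exact hxy (h0.trans h1.symm)
  obtain ⟨t, ht⟩ := IsAlgClosed.exists_root _ hdeg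
  refine ⟨act (γ t) x, act_mem_smoothLocus _ hx, ?_⟩
  rw [hF]
  simpa [IsRoot, sub_eq_zero] using ht

/-- Two smooth points can be moved so that a nonconstant function takes different values. -/
def SAutSeparates (k : Type*) [Field k] (A : Type*) [CommRing A] [Algebra k A] : Prop :=
  ∀ f : A, f ∉ Set.range (algebraMap k A) → ∀ x ∈ smoothLocus k A, ∀ y ∈ smoothLocus k A, x ≠ y →
    ∃ g ∈ SAut k A, act g x f ≠ act g y f

theorem SAutIsInfinitelyTransitive.separates (hA : SAutIsInfinitelyTransitive k A) :
    SAutSeparates k A := by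
  intro f hf x hx y hy hxy
  obtain ⟨x', hx', y', hy', hxy'⟩ := exists_smooth_ne (k := k) hf
  have hne : x' ≠ y' := fun h => hxy' (by rw [h])
  have hinj : ∀ {x y : Point k A}, x ≠ y → Function.Injective ![x, y] := by
    intro x y hxy i j hij
    fin_cases i <;> fin_cases j <;> simp_all
  obtain ⟨g, hg, h⟩ := hA 2 ![x, y] ![x', y'] (hinj hxy) (hinj hne)
    (by simp [Fin.forall_fin_two, hx, hy]) (by simp [Fin.forall_fin_two, hx', hy'])
  have h0 := h 0
  have h1 := h 1
  simp only [Matrix.cons_val_zero, Matrix.cons_val_one] at h0 h1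
  exact ⟨g, hg, by rw [h0, h1]; exact hxy'⟩

end Curves

end AffineVariety

/-! ### The coordinate ring of a suspension -/

namespace AffineVariety

open Polynomial

namespace Suspension

section Basic

variable (k : Type*) [Field k] {A : Type*} [CommRing A] [Algebra k A] (f : A)

/-- The comorphism of the projection `Susp(Y, f) → Y`. -/
noncomputable def base : A →ₐ[k] Suspension f :=
  (Ideal.Quotient.mkₐ k _).comp (IsScalarTower.toAlgHom k A (MvPolynomial (Fin 2) A))

/-- The coordinate `u` of the suspension `{u v = f}`. -/
noncomputable def u : Suspension f := Ideal.Quotient.mk _ (MvPolynomial.X 0)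

/-- The coordinate `v` of the suspension `{u v = f}`. -/
noncomputable def v : Suspension f := Ideal.Quotient.mk _ (MvPolynomial.X 1)

theorem u_mul_v : u f * v f = base k f f := by
  change Ideal.Quotient.mk _ _ = Ideal.Quotient.mk _ (algebraMap A (MvPolynomial (Fin 2) A) f)
  rw [Ideal.Quotient.eq]
  exact Ideal.subset_span rfl

variable {k f}

theorem induction {p : Suspension f → Prop} (hbase : ∀ a, p (base k f a))
    (hadd : ∀ b c, p b → p c → p (b + c)) (hu : ∀ b, p b → p (b * u f))
    (hv : ∀ b, p b → p (b * v f)) (b : Suspension f) : p b := by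
  obtain ⟨b, rfl⟩ := Ideal.Quotient.mk_surjective b
  induction b using MvPolynomial.induction_on with
  | C a => exact hbase a
  | add b c hb hc => rw [map_add]; exact hadd _ _ hb hc
  | mul_X b i hb =>
    rw [map_mul]
    fin_cases i
    · exact hu _ hb
    · exact hv _ hb

theorem adjoin_eq_top :
    Algebra.adjoin k (Set.range (base k f) ∪ {u f, v f}) = ⊤ := by
  rw [eq_top_iff]
  rintro b -
  refine induction (k := k) (p := fun b => b ∈ Algebra.adjoin k _) ?_ ?_ ?_ ?_ b
  · exact fun a => Algebra.subset_adjoin (Or.inl ⟨a, rfl⟩)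
  · exact fun b c hb hc => add_mem hb hc
  · exact fun b hb => mul_mem hb (Algebra.subset_adjoin (Or.inr (by simp)))
  · exact fun b hb => mul_mem hb (Algebra.subset_adjoin (Or.inr (by simp)))

instance [Algebra.FiniteType k A] : Algebra.FiniteType k (Suspension f) :=
  have : Algebra.FiniteType k (MvPolynomial (Fin 2) A) :=
    Algebra.FiniteType.trans (S := A) inferInstance inferInstance
  .of_surjective (Ideal.Quotient.mkₐ k _) Ideal.Quotient.mk_surjective

section Lift

variable {C : Type*} [CommRing C] [Algebra k C]

theorem algHom_ext {φ ψ : Suspension f →ₐ[k] C} (hb : ∀ a, φ (base k f a) = ψ (base k f a))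
    (hu : φ (u f) = ψ (u f)) (hv : φ (v f) = ψ (v f)) : φ = ψ := by
  ext b
  refine induction (k := k) (p := fun b => φ b = ψ b) hb ?_ ?_ ?_ b
  · intro b c h1 h2; rw [map_add, map_add, h1, h2]
  · intro b h; rw [map_mul, map_mul, h, hu]
  · intro b h; rw [map_mul, map_mul, h, hv]

/-- The universal property of the coordinate ring of the suspension. -/
noncomputable def lift (φ : A →ₐ[k] C) (a b : C) (h : a * b = φ f) : Suspension f →ₐ[k] C :=
  Ideal.Quotient.liftₐ _
    ({ MvPolynomial.eval₂Hom (φ : A →+* C) ![a, b] with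
      commutes' := fun c => by
        simp [IsScalarTower.algebraMap_apply k A (MvPolynomial (Fin 2) A)] } :
      MvPolynomial (Fin 2) A →ₐ[k] C) (by
    intro p hp
    rw [← RingHom.mem_ker] at *
    refine (Ideal.span_le.mpr ?_ : Ideal.span _ ≤ RingHom.ker _) hp
    rintro _ rfl
    simp [RingHom.mem_ker, h])

variable (φ : A →ₐ[k] C) (a b : C) (h : a * b = φ f)

@[simp] theorem lift_base (x : A) : lift φ a b h (base k f x) = φ x :=
  MvPolynomial.eval₂_C _ _ _

@[simp] theorem lift_u : lift φ a b h (u f) = a := MvPolynomial.eval₂_X _ _ _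

@[simp] theorem lift_v : lift φ a b h (v f) = b := MvPolynomial.eval₂_X _ _ _

end Lift

end Basic

section Domain

variable (k : Type*) [Field k] {A : Type*} [CommRing A] [Algebra k A] (f : A)

/-- Every function on the suspension is of the form `p(u) + q(v)`, with `q` without constant
term. -/
theorem exists_eq_add (b : Suspension f) : ∃ p q : A[X], q.coeff 0 = 0 ∧
    b = p.eval₂ (base k f : A →+* _) (u f) + q.eval₂ (base k f : A →+* _) (v f) := by
  have huv := u_mul_v k f
  refine induction (k := k) (p := fun b => ∃ p q : A[X], q.coeff 0 = 0 ∧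
    b = p.eval₂ (base k f : A →+* _) (u f) + q.eval₂ (base k f : A →+* _) (v f)) ?_ ?_ ?_ ?_ b
  · exact fun a => ⟨C a, 0, by simp, by simp⟩
  · rintro _ _ ⟨p, q, hq, rfl⟩ ⟨p', q', hq', rfl⟩
    exact ⟨p + p', q + q', by simp [hq, hq'], by simp only [eval₂_add]; ring⟩
  · rintro _ ⟨p, q, hq, rfl⟩
    obtain ⟨r, rfl⟩ := X_dvd_iff.mpr hq
    refine ⟨p * X + C (f * r.coeff 0), C f * (r - C (r.coeff 0)), by simp, ?_⟩
    simp only [eval₂_add, eval₂_mul, eval₂_X, eval₂_C, eval₂_sub, RingHom.coe_coe, map_mul]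
    linear_combination (r.eval₂ (base k f : A →+* _) (v f)) * huv
  · rintro _ ⟨p, q, hq, rfl⟩
    refine ⟨C f * p.divX, q * X + C (p.coeff 0) * X, by simp, ?_⟩
    have hp : p.eval₂ (base k f : A →+* _) (u f) =
        p.divX.eval₂ (base k f : A →+* _) (u f) * u f + base k f (p.coeff 0) := by
      conv_lhs => rw [← p.divX_mul_X_add]
      simp
    rw [hp]
    simp only [eval₂_add, eval₂_mul, eval₂_X, eval₂_C, RingHom.coe_coe]
    linear_combination (p.divX.eval₂ (base k f : A →+* _) (u f)) * huv

open LaurentPolynomial in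
theorem coeff_eval₂_C_mul_T (p : A[X]) (c : A) (n m : ℤ) :
    (p.eval₂ LaurentPolynomial.C (LaurentPolynomial.C c * T n)).coeff m =
      ∑ i ∈ p.support, if i * n = m then p.coeff i * c ^ i else 0 := by
  rw [eval₂_eq_sum, Polynomial.sum, AddMonoidAlgebra.coeff_sum, Finsupp.finsetSum_apply]
  refine Finset.sum_congr rfl fun i _ => ?_
  have h : LaurentPolynomial.C (p.coeff i) * (LaurentPolynomial.C c * T n) ^ i =
      .single (i * n) (p.coeff i * c ^ i) := by
    rw [single_eq_C_mul_T, mul_pow, T_pow, map_mul, map_pow, mul_assoc]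
  rw [h, AddMonoidAlgebra.coeff_single, Finsupp.single_apply]

open LaurentPolynomial in
/-- The restriction of functions to the open subset `u ≠ 0` of the suspension, which is
`Y × (𝔸¹ ∖ 0)`. -/
noncomputable def toLaurent : Suspension f →ₐ[k] A[T;T⁻¹] :=
  lift (IsScalarTower.toAlgHom k A A[T;T⁻¹]) (T 1) (LaurentPolynomial.C f * T (-1)) (by
    rw [mul_comm, mul_assoc, ← T_add]
    simp [LaurentPolynomial.algebraMap_apply])

theorem toLaurent_injective [IsDomain A] (hf : f ≠ 0) : Function.Injective (toLaurent k f) := by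
  rw [injective_iff_map_eq_zero]
  intro b hb
  obtain ⟨p, q, hq, rfl⟩ := exists_eq_add k f b
  have hcomp : (toLaurent k f : Suspension f →+* LaurentPolynomial A).comp (base k f : A →+* _) =
      LaurentPolynomial.C := by
    ext1 a
    simp [toLaurent, LaurentPolynomial.algebraMap_apply]
  have key : ∀ (r : A[X]) (z : Suspension f), toLaurent k f (r.eval₂ (base k f : A →+* _) z) =
      r.eval₂ LaurentPolynomial.C (toLaurent k f z) := by
    intro r z
    rw [← hcomp]
    exact hom_eval₂ r _ (toLaurent k f : Suspension f →+* LaurentPolynomial A) z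
  have hu : toLaurent k f (u f) = LaurentPolynomial.C 1 * LaurentPolynomial.T 1 := by
    simp [toLaurent]
  have hv : toLaurent k f (v f) = LaurentPolynomial.C f * LaurentPolynomial.T (-1) := by
    simp [toLaurent]
  rw [map_add, key, key, hu, hv] at hb
  have hm : ∀ m : ℤ, (∑ i ∈ p.support, if i * (1 : ℤ) = m then p.coeff i * 1 ^ i else 0) +
      (∑ i ∈ q.support, if i * (-1 : ℤ) = m then q.coeff i * f ^ i else 0) = 0 := by
    intro m
    have := congrArg (fun z => z.coeff m) hb
    simpa only [AddMonoidAlgebra.coeff_add, Finsupp.add_apply, coeff_eval₂_C_mul_T,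
      AddMonoidAlgebra.coeff_zero, Finsupp.coe_zero, Pi.zero_apply] using this
  have hsum : ∀ (r : A[X]) (c : A) (n : ℕ) (ε : ℤ), ε ≠ 0 →
      (∑ i ∈ r.support, if i * ε = n * ε then r.coeff i * c ^ i else 0) = r.coeff n * c ^ n := by
    intro r c n ε hε
    have h : ∀ i : ℕ, ((i : ℤ) * ε = n * ε) ↔ i = n := fun i => by
      rw [mul_left_inj' hε]; exact Int.natCast_inj
    simp only [h, Finset.sum_ite_eq', mem_support_iff]
    by_cases h0 : r.coeff n = 0 <;> simp [h0]
  have hp0 : p = 0 := by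
    ext n
    have h := hm n
    have h1 := hsum p 1 n 1 one_ne_zero
    have h2 : (∑ i ∈ q.support, if i * (-1 : ℤ) = n then q.coeff i * f ^ i else 0) = 0 := by
      refine Finset.sum_eq_zero fun i hi => ?_
      split_ifs with h
      · have : i = 0 := by omega
        simp [this, hq]
      · rfl
    rw [mul_one] at h1
    rw [h1, h2] at h
    simpa using h
  subst hp0
  have hq0 : q = 0 := by
    ext n
    have h := hm (n * (-1))
    rw [hsum q f n (-1) (by norm_num)] at h
    simpa [hf] using h
  simp [hq0]

theorem isDomain (k : Type*) [Field k] {A : Type*} [CommRing A] [Algebra k A] (f : A)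
    [IsDomain A] (hf : f ≠ 0) : IsDomain (Suspension f) :=
  have : IsDomain (LaurentPolynomial A) := NoZeroDivisors.to_isDomain _
  (toLaurent_injective k f hf).isDomain (toLaurent k f : Suspension f →+* LaurentPolynomial A)

theorem u_ne_zero (k : Type*) [Field k] {A : Type*} [CommRing A] [Algebra k A] (f : A)
    [IsDomain A] : u f ≠ 0 := by
  intro h
  have : toLaurent k f (u f) = LaurentPolynomial.T 1 := lift_u _ _ _ _
  rw [h, map_zero] at this
  exact (LaurentPolynomial.isUnit_T 1).ne_zero this.symm

end Domain

section Dimension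

variable (k : Type*) [Field k] {A : Type*} [CommRing A] [Algebra k A] (f : A)

/-- The suspension is finite over `Y × 𝔸¹` by the projection `(y, u, v) ↦ (y, u + v)`: both `u` and
`v` are roots of `T² - (u + v) T + f`. -/
theorem ringKrullDim_eq [IsDomain A] [Algebra.FiniteType k A] :
    ringKrullDim (Suspension f) = ringKrullDim A + 1 := by
  have := Algebra.FiniteType.isNoetherianRing k A
  rw [← Polynomial.ringKrullDim_of_isNoetherianRing (R := A)]
  let ρ : A[X] →+* Suspension f := eval₂RingHom (base k f : A →+* _) (u f + v f)
  have hρC : ∀ a, ρ (C a) = base k f a := fun a => by simp [ρ]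
  have hρX : ρ X = u f + v f := by simp [ρ]
  let Q : A[X][X] := X ^ 2 - C X * X + C (C f)
  let R : A[X][X] := C (-X) * X + C (C f)
  have hRdeg : R.degree < 2 := lt_of_le_of_lt degree_linear_le (by norm_num)
  have hQ : Q = X ^ 2 + R := by simp only [Q, R, map_neg]; ring
  have hQmonic : Q.Monic := hQ ▸ monic_X_pow_add hRdeg
  have hQdeg0 : Q.degree ≠ 0 := by
    rw [hQ, degree_add_eq_left_of_degree_lt (by rwa [degree_X_pow]), degree_X_pow]
    norm_num
  have hroot : AdjoinRoot.root Q * (AdjoinRoot.of Q X - AdjoinRoot.root Q) =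
      AdjoinRoot.of Q (C f) := by
    have h := AdjoinRoot.eval₂_root Q
    simp only [Q, eval₂_add, eval₂_sub, eval₂_pow, eval₂_mul, eval₂_X, eval₂_C] at h
    linear_combination -h
  let φ : A →ₐ[k] AdjoinRoot Q :=
    { (AdjoinRoot.of Q).comp C with
      commutes' := fun c => rfl }
  let σ : Suspension f →ₐ[k] AdjoinRoot Q :=
    lift φ (AdjoinRoot.root Q) (AdjoinRoot.of Q X - AdjoinRoot.root Q) hroot
  -- Mapping `u` to the root of `T² - w T + f` over `k[Y × 𝔸¹]` shows that `ρ` is injective.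
  have hσ : (σ : Suspension f →+* _).comp ρ = AdjoinRoot.of Q := by
    refine Polynomial.ringHom_ext (fun a => ?_) ?_
    · simp only [RingHom.comp_apply, hρC, σ, RingHom.coe_coe, lift_base]
      rfl
    · simp [hρX, σ]
  have hinj : Function.Injective ρ := by
    have h := AdjoinRoot.of.injective_of_degree_ne_zero hQdeg0
    rw [← hσ] at h
    exact Function.Injective.of_comp h
  have hu : ρ.IsIntegralElem (u f) := by
    refine ⟨Q, hQmonic, ?_⟩
    simp only [Q, eval₂_add, eval₂_sub, eval₂_pow, eval₂_mul, eval₂_X, eval₂_C, hρX, hρC,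
      ← u_mul_v k f]
    ring
  have hv : ρ.IsIntegralElem (v f) := by
    refine ⟨Q, hQmonic, ?_⟩
    simp only [Q, eval₂_add, eval₂_sub, eval₂_pow, eval₂_mul, eval₂_X, eval₂_C, hρX, hρC,
      ← u_mul_v k f]
    ring
  have hint : ρ.IsIntegral := by
    refine induction (k := k) ?_ ?_ ?_ ?_
    · intro a
      rw [← hρC]
      exact ρ.isIntegralElem_map
    · exact fun b c hb hc => RingHom.IsIntegralElem.add ρ hb hc
    · exact fun b hb => RingHom.IsIntegralElem.mul ρ hb hu
    · exact fun b hb => RingHom.IsIntegralElem.mul ρ hb hv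
  let := ρ.toAlgebra
  have : Algebra.IsIntegral A[X] (Suspension f) := ⟨hint⟩
  exact ringKrullDim_eq_of_isIntegral_of_injective hinj

end Dimension

section Points

variable {k : Type*} [Field k] {A : Type*} [CommRing A] [Algebra k A] {f : A}

/-- The image in `Y` of a point of the suspension. -/
noncomputable def proj (x : Point k (Suspension f)) : Point k A := x.comp (base k f)

theorem apply_base (x : Point k (Suspension f)) (a : A) : x (base k f a) = proj x a := rfl

theorem apply_u_mul_apply_v (x : Point k (Suspension f)) : x (u f) * x (v f) = proj x f := by
  rw [← map_mul, u_mul_v k, apply_base]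

theorem point_ext {x y : Point k (Suspension f)} (hp : proj x = proj y) (hu : x (u f) = y (u f))
    (hv : x (v f) = y (v f)) : x = y :=
  algHom_ext (fun a => DFunLike.congr_fun hp a) hu hv

theorem point_ext_of_u_ne_zero {x y : Point k (Suspension f)} (hp : proj x = proj y)
    (hu : x (u f) = y (u f)) (h0 : x (u f) ≠ 0) : x = y := by
  refine point_ext hp hu (mul_left_cancel₀ h0 ?_)
  rw [apply_u_mul_apply_v]
  conv_rhs => rw [hu]
  rw [apply_u_mul_apply_v, hp]

/-- The equation `u dv + v du = df` of the tangent space of the suspension inside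
`T_y Y × 𝔸²`. -/
noncomputable def tangentEquation (x : Point k (Suspension f)) :
    tangentSpace (proj x) × k × k →ₗ[k] k where
  toFun D := x (u f) * D.2.2 + x (v f) * D.2.1 - D.1.1 f
  map_add' D E := by simp; ring
  map_smul' c D := by simp; ring

theorem tangent_relation {x : Point k (Suspension f)} (D : tangentSpace x) :
    x (u f) * D.1 (v f) + x (v f) * D.1 (u f) = D.1 (base k f f) := by
  rw [← u_mul_v k f, tangentSpace_apply_mul]

/-- The embedding of the tangent space of the suspension in `T_y Y × 𝔸²`. -/
noncomputable def tangentMap (x : Point k (Suspension f)) :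
    tangentSpace x →ₗ[k] tangentSpace (proj x) × k × k where
  toFun D := ⟨⟨D.1.comp (base k f).toLinearMap, fun a b => by
    simp [tangentSpace_apply_mul, apply_base]⟩, D.1 (u f), D.1 (v f)⟩
  map_add' _ _ := rfl
  map_smul' _ _ := rfl

theorem tangentMap_injective (x : Point k (Suspension f)) : Function.Injective (tangentMap x) := by
  rw [injective_iff_map_eq_zero]
  intro D hD
  have h1 : ∀ a, D.1 (base k f a) = 0 := fun a =>
    LinearMap.congr_fun (congrArg (fun z => (z.1 : A →ₗ[k] k)) hD) a
  have h2 : D.1 (u f) = 0 := congrArg (fun z => z.2.1) hD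
  have h3 : D.1 (v f) = 0 := congrArg (fun z => z.2.2) hD
  refine Subtype.ext (LinearMap.ext fun b => ?_)
  have hb : b ∈ Algebra.adjoin k (Set.range (base k f) ∪ {u f, v f}) := by
    rw [adjoin_eq_top]; exact Algebra.mem_top
  refine tangentSpace_apply_eq_zero_of_mem_adjoin D ?_ hb
  rintro _ (⟨a, rfl⟩ | rfl | rfl)
  exacts [h1 a, h2, h3]

/-- A tangent vector as a point with values in the dual numbers. -/
def dualPoint {R : Type*} [CommRing R] [Algebra k R] (y : Point k R) (D : tangentSpace y) :
    R →ₐ[k] TrivSqZeroExt k k :=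
  AlgHom.mk
    { toFun := fun a => (y a, D.1 a)
      map_one' := Prod.ext (map_one y) (tangentSpace_apply_one D)
      map_zero' := Prod.ext (map_zero y) (map_zero D.1)
      map_add' := fun a b => Prod.ext (map_add y a b) (map_add D.1 a b)
      map_mul' := fun a b => TrivSqZeroExt.ext (map_mul y a b) (by
        refine Eq.trans ?_
          (TrivSqZeroExt.snd_mul (R := k) (M := k) (y a, D.1 a) (y b, D.1 b)).symm
        refine (tangentSpace_apply_mul D a b).trans ?_
        rw [mul_comm (y b)]
        rfl) }
    (fun c => TrivSqZeroExt.ext (y.commutes c) (tangentSpace_apply_algebraMap D c))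

/-- The tangent vector given by a point with values in the dual numbers. -/
def ofDualPoint {R : Type*} [CommRing R] [Algebra k R] (y : Point k R)
    (ψ : R →ₐ[k] TrivSqZeroExt k k) (hψ : ∀ a, (ψ a).fst = y a) : tangentSpace y :=
  ⟨(TrivSqZeroExt.sndHom k k).comp ψ.toLinearMap, fun a b => by
    change (ψ (a * b)).snd = y a * (ψ b).snd + y b * (ψ a).snd
    rw [map_mul, TrivSqZeroExt.snd_mul, ← hψ, ← hψ, mul_comm (ψ b).fst]
    rfl⟩

theorem range_tangentMap (x : Point k (Suspension f)) :
    LinearMap.range (tangentMap x) = LinearMap.ker (tangentEquation x) := by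
  apply le_antisymm
  · rintro _ ⟨D, rfl⟩
    rw [LinearMap.mem_ker]
    exact sub_eq_zero.mpr (tangent_relation D)
  · rintro ⟨D, p, q⟩ h
    have h : x (u f) * q + x (v f) * p - D.1 f = 0 := h
    let a : TrivSqZeroExt k k := (x (u f), p)
    let b : TrivSqZeroExt k k := (x (v f), q)
    have hab : a * b = dualPoint (proj x) D f := by
      refine TrivSqZeroExt.ext (apply_u_mul_apply_v x) ?_
      rw [TrivSqZeroExt.snd_mul]
      refine Eq.trans ?_ (sub_eq_zero.mp h)
      rw [mul_comm (x (v f))]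
      rfl
    let ψ := lift (dualPoint (proj x) D) a b hab
    have hψb : ∀ c, ψ (base k f c) = dualPoint (proj x) D c := lift_base _ _ _ _
    have hψu : ψ (u f) = a := lift_u _ _ _ _
    have hψv : ψ (v f) = b := lift_v _ _ _ _
    have hψ : (TrivSqZeroExt.fstHom k k k).comp ψ = x := by
      refine algHom_ext (fun c => ?_) ?_ ?_
      · rw [AlgHom.comp_apply, hψb]; rfl
      · rw [AlgHom.comp_apply, hψu]; rfl
      · rw [AlgHom.comp_apply, hψv]; rfl
    refine ⟨ofDualPoint x ψ fun c => DFunLike.congr_fun hψ c, ?_⟩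
    have h1 : (tangentMap x (ofDualPoint x ψ fun c => DFunLike.congr_fun hψ c)).1 = D :=
      Subtype.ext (LinearMap.ext fun c => congrArg TrivSqZeroExt.snd (hψb c))
    have h2 : (ψ (u f)).snd = p := congrArg TrivSqZeroExt.snd hψu
    have h3 : (ψ (v f)).snd = q := congrArg TrivSqZeroExt.snd hψv
    exact Prod.ext h1 (Prod.ext h2 h3)

theorem finrank_tangentSpace_add_finrank_range [Algebra.FiniteType k A]
    (x : Point k (Suspension f)) :
    Module.finrank k (LinearMap.range (tangentEquation x)) + Module.finrank k (tangentSpace x) =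
      Module.finrank k (tangentSpace (proj x)) + 2 := by
  have h1 := LinearMap.finrank_range_add_finrank_ker (K := k)
    (V := tangentSpace (proj x) × k × k) (tangentEquation x)
  rw [← range_tangentMap, LinearMap.finrank_range_of_inj (tangentMap_injective x)] at h1
  have : Module.Free k (tangentSpace (proj x)) :=
    Module.Free.of_divisionRing k (tangentSpace (proj x))
  rw [h1, Module.finrank_prod, Module.finrank_prod, Module.finrank_self]

/-- The image in `Y` of a smooth point of the suspension is smooth, and the equation of the
suspension has nonzero differential there. -/
theorem smooth_proj [IsDomain A] [Algebra.FiniteType k A] {x : Point k (Suspension f)}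
    (hx : x ∈ smoothLocus k (Suspension f)) :
    proj x ∈ smoothLocus k A ∧ tangentEquation x ≠ 0 := by
  have h1 := finrank_tangentSpace_add_finrank_range x
  have h2 := ringKrullDim_le_finrank_tangentSpace (proj x)
  have h3 : (Module.finrank k (tangentSpace x) : WithBot ℕ∞) = ringKrullDim (Suspension f) := hx
  rw [ringKrullDim_eq k f] at h3
  obtain ⟨d, -, -, -, hd⟩ := exists_integral_mvPolynomial_ringKrullDim_eq k A
  rw [hd] at h2 h3
  have h2' : d ≤ Module.finrank k (tangentSpace (proj x)) := by exact_mod_cast h2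
  have h3' : Module.finrank k (tangentSpace x) = d + 1 := by exact_mod_cast h3
  have h4 : Module.finrank k (LinearMap.range (tangentEquation x)) ≤ 1 := by
    simpa using Submodule.finrank_le (LinearMap.range (tangentEquation x))
  constructor
  · change (Module.finrank k (tangentSpace (proj x)) : WithBot ℕ∞) = ringKrullDim A
    rw [hd]
    have : Module.finrank k (tangentSpace (proj x)) = d := by omega
    rw [this]
  · intro h0
    rw [h0, LinearMap.range_zero, finrank_bot] at h1
    omega

end Points

end Suspension

end AffineVariety

/-! ### Lifting automorphisms to the suspension -/

namespace AffineVariety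

open Polynomial

theorem apply_eval_map {k : Type*} [Field k] {R S : Type*} [CommRing R] [Algebra k R] [CommRing S]
    [Algebra k S] (x : Point k S) (φ : R →ₐ[k] S) (F : R[X]) (z : S) :
    x ((F.map (φ : R →+* S)).eval z) = F.eval₂ (x.comp φ : R →+* k) (x z) := by
  rw [eval_map]
  exact hom_eval₂ F (φ : R →+* S) (x : S →+* k) z

theorem GaAction.apply_comorphism {k : Type*} [Field k] {A : Type*} [CommRing A] [Algebra k A]
    (H : GaAction k A) (x : Point k A) (t : k) (a : A) :
    x (H.comorphism t a) = (H.coact a).eval₂ (x : A →+* k) t := by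
  rw [H.comorphism_apply]
  have := hom_eval₂ (H.coact a) (RingHom.id A) (x : A →+* k) (algebraMap k A t)
  simpa using this

/-- The point `t.x`. -/
noncomputable def GaAction.flow {k : Type*} [Field k] {A : Type*} [CommRing A] [Algebra k A]
    (H : GaAction k A) (t : k) (x : Point k A) : Point k A := x.comp (H.comorphism t)

theorem GaAction.act_toAut {k : Type*} [Field k] {A : Type*} [CommRing A] [Algebra k A]
    (H : GaAction k A) (t : k) (x : Point k A) : act (H.toAut t) x = H.flow (-t) x := rfl

theorem GaAction.flow_zero {k : Type*} [Field k] {A : Type*} [CommRing A] [Algebra k A]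
    (H : GaAction k A) (x : Point k A) : H.flow 0 x = x := by
  rw [GaAction.flow, H.comorphism_zero]
  rfl

theorem GaAction.flow_add {k : Type*} [Field k] {A : Type*} [CommRing A] [Algebra k A]
    (H : GaAction k A) (s t : k) (x : Point k A) : H.flow s (H.flow t x) = H.flow (s + t) x := by
  rw [GaAction.flow, GaAction.flow, GaAction.flow, AlgHom.comp_assoc, H.comorphism_comp]

namespace Suspension

section LiftAction

variable {k : Type*} [Field k] {A : Type*} [CommRing A] [Algebra k A] (f : A)
variable (H : GaAction k A) (r : k[X])

/-- The function `u r(u)` on the suspension. -/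
noncomputable def replica : Suspension f := u f * aeval (u f) r

/-- On functions on `Y`, the lifted action runs the given action for the time `t u r(u)`. -/
noncomputable def liftCoactBase : A →ₐ[k] (Suspension f)[X] :=
  ((aeval (C (replica f r) * X) :
    (Suspension f)[X] →ₐ[Suspension f] (Suspension f)[X]).restrictScalars k).comp
    ((mapAlgHom (base k f)).comp H.coact)

theorem liftCoactBase_apply (a : A) : liftCoactBase f H r a =
    ((H.coact a).map (base k f : A →+* _)).comp (C (replica f r) * X) := by
  simp [liftCoactBase, comp, aeval_def]

/-- On the coordinate `v`, the lifted action is `v ↦ (f (t u r(u) . y)) / u`. -/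
noncomputable def liftCoactV : (Suspension f)[X] :=
  C (v f) + X * C (aeval (u f) r) *
    (((H.coact f).divX).map (base k f : A →+* _)).comp (C (replica f r) * X)

theorem u_mul_liftCoactV : C (u f) * liftCoactV f H r = liftCoactBase f H r f := by
  have h0 : (H.coact f).coeff 0 = f := by rw [coeff_zero_eq_eval_zero, H.coact_zero]
  rw [liftCoactBase_apply, liftCoactV]
  conv_rhs => rw [← (H.coact f).divX_mul_X_add, h0]
  simp only [Polynomial.map_add, Polynomial.map_mul, map_X, map_C, add_comp, mul_comp, X_comp,
    C_comp, RingHom.coe_coe, ← u_mul_v k f, replica, map_mul]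
  ring

/-- The comorphism of the lifted action. -/
noncomputable def liftCoact : Suspension f →ₐ[k] (Suspension f)[X] :=
  lift (liftCoactBase f H r) (C (u f)) (liftCoactV f H r) (u_mul_liftCoactV f H r)

variable {f}

theorem apply_replica (x : Point k (Suspension f)) :
    x (replica f r) = x (u f) * r.eval (x (u f)) := by
  rw [replica, map_mul, ← aeval_algHom_apply, coe_aeval_eq_eval]

theorem apply_liftCoact_base (x : Point k (Suspension f)) (t : k) (a : A) :
    x ((liftCoact f H r (base k f a)).eval (algebraMap k _ t)) =
      H.flow (t * (x (u f) * r.eval (x (u f)))) (proj x) a := by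
  rw [liftCoact, lift_base, liftCoactBase_apply, eval_comp, apply_eval_map, GaAction.flow,
    AlgHom.comp_apply, H.apply_comorphism]
  congr 1
  simp [apply_replica, mul_comm]

theorem liftCoact_u (z : Suspension f) : (liftCoact f H r (u f)).eval z = u f := by
  rw [liftCoact, lift_u, eval_C]

theorem apply_liftCoact_v (x : Point k (Suspension f)) (t : k) :
    x ((liftCoact f H r (v f)).eval (algebraMap k _ t)) = x (v f) + t * r.eval (x (u f)) *
      (H.coact f).divX.eval₂ (proj x : A →+* k) (t * (x (u f) * r.eval (x (u f)))) := by
  rw [liftCoact, lift_v, liftCoactV, eval_add, eval_mul, eval_mul, eval_comp, map_add, map_mul,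
    map_mul, apply_eval_map]
  simp only [eval_C, eval_X, eval_mul, map_mul, AlgHom.commutes, Algebra.algebraMap_self,
    RingHom.id_apply, ← aeval_algHom_apply, coe_aeval_eq_eval, apply_replica]
  rw [mul_comm (x (u f) * _) t]
  rfl

/-- The lift of an action of `G_a` on `Y` to the suspension that fixes the coordinate `u` and runs
the given action at the speed `u r(u)`. -/
noncomputable def liftAction [IsAlgClosed k] [Algebra.FiniteType k A] [IsDomain A]
    [IsDomain (Suspension f)] : GaAction k (Suspension f) where
  coact := liftCoact f H r
  coact_zero b := by
    let φ : Suspension f →ₐ[k] Suspension f :=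
      ((aeval 0 : (Suspension f)[X] →ₐ[Suspension f] Suspension f).restrictScalars k).comp
        (liftCoact f H r)
    have hφ : ∀ b, φ b = (liftCoact f H r b).eval (algebraMap k _ 0) := fun b => by
      simp [φ]
    have : φ = AlgHom.id k _ := by
      refine algHom_ext (fun a => ?_) ?_ ?_
      · refine eq_of_forall_point (k := k) fun x => ?_
        rw [hφ, apply_liftCoact_base, zero_mul, H.flow_zero]
        rfl
      · rw [hφ, liftCoact_u]; rfl
      · refine eq_of_forall_point (k := k) fun x => ?_
        rw [hφ, apply_liftCoact_v]
        simp
    have h := hφ b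
    rw [this, map_zero] at h
    exact h.symm
  coact_add s t b := by
    let φ : k → (Suspension f →ₐ[k] Suspension f) := fun t =>
      ((aeval (algebraMap k _ t) : (Suspension f)[X] →ₐ[Suspension f] Suspension f).restrictScalars
        k).comp (liftCoact f H r)
    have hφ : ∀ t b, φ t b = (liftCoact f H r b).eval (algebraMap k _ t) := fun t b => by
      simp [φ]
    have hproj : ∀ (x : Point k (Suspension f)) (t : k) (a : A), x (φ t (base k f a)) =
        H.flow (t * (x (u f) * r.eval (x (u f)))) (proj x) a := fun x t a => by
      rw [hφ, apply_liftCoact_base]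
    have hu : ∀ t, φ t (u f) = u f := fun t => by rw [hφ, liftCoact_u]
    have hbase : ∀ a, φ t (φ s (base k f a)) = φ (s + t) (base k f a) := by
      intro a
      refine eq_of_forall_point (k := k) fun x => ?_
      have hx : proj (x.comp (φ t)) =
          H.flow (t * (x (u f) * r.eval (x (u f)))) (proj x) := by
        ext a
        exact hproj x t a
      have hxu : (x.comp (φ t)) (u f) = x (u f) := congrArg x (hu t)
      have := hproj (x.comp (φ t)) s a
      rw [hx, hxu, H.flow_add] at this
      rw [hproj, add_mul]
      exact this
    have : (φ t).comp (φ s) = φ (s + t) := by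
      refine algHom_ext hbase ?_ ?_
      · rw [AlgHom.comp_apply, hu, hu, hu]
      · have hu2 : (φ t).comp (φ s) (u f) = u f := (congrArg (φ t) (hu s)).trans (hu t)
        refine mul_left_cancel₀ (u_ne_zero k f) ?_
        calc u f * (φ t).comp (φ s) (v f) = (φ t).comp (φ s) (u f * v f) := by
              rw [map_mul, hu2]
          _ = φ (s + t) (u f * v f) := by
              rw [u_mul_v k f]; exact hbase f
          _ = u f * φ (s + t) (v f) := by rw [map_mul, hu]
    have h := DFunLike.congr_fun this b
    rw [AlgHom.comp_apply, hφ, hφ, hφ] at h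
    exact h

variable [IsAlgClosed k] [Algebra.FiniteType k A] [IsDomain A] [IsDomain (Suspension f)]

theorem liftAction_flow_u (t : k) (x : Point k (Suspension f)) :
    (liftAction H r).flow t x (u f) = x (u f) := by
  rw [GaAction.flow, AlgHom.comp_apply, GaAction.comorphism_apply]
  exact congrArg x (liftCoact_u H r _)

theorem proj_liftAction_flow (t : k) (x : Point k (Suspension f)) :
    proj ((liftAction H r).flow t x) = H.flow (t * (x (u f) * r.eval (x (u f)))) (proj x) := by
  ext a
  rw [← apply_base, GaAction.flow, AlgHom.comp_apply, GaAction.comorphism_apply]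
  exact apply_liftCoact_base H r x t a

theorem liftAction_flow_v_of_u_eq_zero (t : k) {x : Point k (Suspension f)} (hx : x (u f) = 0) :
    (liftAction H r).flow t x (v f) =
      x (v f) + t * r.eval 0 * (H.tangentVector (proj x)).1 f := by
  rw [GaAction.flow, AlgHom.comp_apply, GaAction.comorphism_apply]
  refine (apply_liftCoact_v H r x t).trans ?_
  rw [hx, zero_mul, mul_zero, eval₂_at_zero]
  change _ = x (v f) + t * r.eval 0 * proj x ((derivative (H.coact f)).eval 0)
  rw [← coeff_zero_eq_eval_zero (derivative _), coeff_derivative, coeff_divX]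
  simp

end LiftAction

section Swap

variable (k : Type*) [Field k] {A : Type*} [CommRing A] [Algebra k A] (f : A)

theorem v_mul_u : v f * u f = base k f f := by rw [mul_comm, u_mul_v k f]

/-- The involution of the suspension that exchanges the coordinates `u` and `v`. -/
noncomputable def swap : Suspension f ≃ₐ[k] Suspension f :=
  AlgEquiv.ofAlgHom (lift (base k f) (v f) (u f) (v_mul_u k f))
    (lift (base k f) (v f) (u f) (v_mul_u k f))
    (algHom_ext (by simp) (by simp) (by simp)) (algHom_ext (by simp) (by simp) (by simp))

theorem swap_u : swap k f (u f) = v f := lift_u _ _ _ (v_mul_u k f)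

theorem swap_v : swap k f (v f) = u f := lift_v _ _ _ (v_mul_u k f)

theorem swap_base (a : A) : swap k f (base k f a) = base k f a :=
  lift_base _ _ _ (v_mul_u k f) a

theorem swap_symm : (swap k f).symm = swap k f := rfl

variable {k f}

theorem act_swap_u (x : Point k (Suspension f)) : act (swap k f) x (u f) = x (v f) := by
  rw [act_apply, swap_symm, swap_u]

theorem act_swap_v (x : Point k (Suspension f)) : act (swap k f) x (v f) = x (u f) := by
  rw [act_apply, swap_symm, swap_v]

theorem proj_act_swap (x : Point k (Suspension f)) : proj (act (swap k f) x) = proj x := by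
  ext a
  rw [← apply_base, act_apply, swap_symm, swap_base]
  rfl

/-- Conjugation by `swap` turns special automorphisms into special automorphisms. -/
theorem exists_swap_act {g : Suspension f ≃ₐ[k] Suspension f} (hg : g ∈ SAut k (Suspension f)) :
    ∃ h ∈ SAut k (Suspension f), ∀ x, act h x = act (swap k f) (act g (act (swap k f) x)) :=
  ⟨conjAut (swap k f) g, conjAut_mem_SAut _ hg, fun _ => rfl⟩

end Swap

section Fibers

variable {k : Type*} [Field k] {A : Type*} [CommRing A] [Algebra k A] {f : A}
variable [IsAlgClosed k] [Algebra.FiniteType k A] [IsDomain A] [IsDomain (Suspension f)]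

/-- A special automorphism of `Y` lifts to the suspension in such a way that it acts by the given
one on the fibre `u = c`, isomorphic to `Y`, and trivially on finitely many other fibres. -/
theorem exists_lift_fiber {g : A ≃ₐ[k] A} (hg : g ∈ SAut k A) {c : k} (hc : c ≠ 0)
    {S : Finset k} (hS : c ∉ S) : ∃ h ∈ SAut k (Suspension f),
      (∀ x : Point k (Suspension f), act h x (u f) = x (u f)) ∧
      (∀ x : Point k (Suspension f), x (u f) = c → proj (act h x) = act g (proj x)) ∧
      (∀ x : Point k (Suspension f), x (u f) ∈ S → proj (act h x) = proj x) := by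
  refine SAut_induction (p := fun g => ∃ h ∈ SAut k (Suspension f),
      (∀ x : Point k (Suspension f), act h x (u f) = x (u f)) ∧
      (∀ x : Point k (Suspension f), x (u f) = c → proj (act h x) = act g (proj x)) ∧
      (∀ x : Point k (Suspension f), x (u f) ∈ S → proj (act h x) = proj x)) ?_ ?_ ?_ hg
  · exact ⟨1, one_mem _, fun _ => rfl, fun _ _ => rfl, fun _ _ => rfl⟩
  · intro H t
    let p : k[X] := ∏ d ∈ S, (X - C d)
    have hp : p.eval c ≠ 0 := by
      rw [eval_prod, Finset.prod_ne_zero_iff]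
      intro d hd
      rw [eval_sub, eval_X, eval_C]
      exact sub_ne_zero.mpr fun h => hS (h ▸ hd)
    -- The speed `u r(u)` is `1` on the fibre `u = c` and `0` on the other fibres.
    let r : k[X] := C (c * p.eval c)⁻¹ * p
    refine ⟨(liftAction H r).toAut t, GaAction.toAut_mem_SAut _ _, fun x => ?_, fun x hx => ?_,
      fun x hx => ?_⟩
    · rw [GaAction.act_toAut, liftAction_flow_u]
    · rw [GaAction.act_toAut, proj_liftAction_flow, GaAction.act_toAut, hx]
      congr 1
      simp only [r, eval_mul, eval_C]
      field_simp
    · rw [GaAction.act_toAut, proj_liftAction_flow]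
      have : r.eval (x (u f)) = 0 := by
        have hpx : p.eval (x (u f)) = 0 := by
          rw [eval_prod]
          exact Finset.prod_eq_zero hx (by simp)
        simp only [r, eval_mul, hpx, mul_zero]
      rw [this, mul_zero, mul_zero, H.flow_zero]
  · rintro g g' ⟨h, hh, h1, h2, h3⟩ ⟨h', hh', h1', h2', h3'⟩
    refine ⟨h * h', mul_mem hh hh', fun x => ?_, fun x hx => ?_, fun x hx => ?_⟩
    · rw [act_mul, h1, h1']
    · rw [act_mul, act_mul, h2 _ (by rw [h1', hx]), h2' _ hx]
    · rw [act_mul, h3 _ (by rwa [h1']), h3' _ hx]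

/-- Points in distinct fibres `u = c ≠ 0` can be moved independently within these fibres. -/
theorem exists_move_in_fibers (hA : SAutIsTransitive k A) {ι : Type*} [Finite ι]
    (x : ι → Point k (Suspension f)) (hu : Function.Injective fun i => x i (u f))
    (hu0 : ∀ i, x i (u f) ≠ 0) (hx : ∀ i, proj (x i) ∈ smoothLocus k A)
    (y : ι → Point k A) (hy : ∀ i, y i ∈ smoothLocus k A) :
    ∃ h ∈ SAut k (Suspension f), ∀ i, act h (x i) (u f) = x i (u f) ∧ proj (act h (x i)) = y i := by
  classical
  have := Fintype.ofFinite ι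
  suffices h : ∀ s : Finset ι, ∃ h ∈ SAut k (Suspension f), ∀ i, act h (x i) (u f) = x i (u f) ∧
      proj (act h (x i)) = if i ∈ s then y i else proj (x i) by
    obtain ⟨h, hh, hi⟩ := h Finset.univ
    exact ⟨h, hh, fun i => by simpa using hi i⟩
  intro s
  induction s using Finset.induction_on with
  | empty => exact ⟨1, one_mem _, fun i => ⟨rfl, rfl⟩⟩
  | insert j s hj ih =>
    obtain ⟨h, hh, hi⟩ := ih
    obtain ⟨g, hg, hgj⟩ := hA _ (hx j) _ (hy j)
    obtain ⟨h', hh', h1, h2, h3⟩ := exists_lift_fiber (f := f) hg (hu0 j)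
      (S := (Finset.univ.erase j).image fun i => x i (u f)) (by
        simp only [Finset.mem_image, Finset.mem_erase, not_exists, not_and]
        exact fun i hi h => hi.1 (hu h))
    refine ⟨h' * h, mul_mem hh' hh, fun i => ⟨by rw [act_mul, h1, (hi i).1], ?_⟩⟩
    rw [act_mul]
    by_cases hij : i = j
    · subst hij
      rw [h2 _ (hi i).1, (hi i).2, if_neg hj, hgj, if_pos (by simp)]
    · rw [h3 _ (by rw [(hi i).1]; exact Finset.mem_image_of_mem _ (by simp [hij])), (hi i).2]
      simp [hij]

/-- The analogue of `exists_move_in_fibers` for the coordinate `v`. -/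
theorem exists_move_in_fibers' (hA : SAutIsTransitive k A) {ι : Type*} [Finite ι]
    (x : ι → Point k (Suspension f)) (hv : Function.Injective fun i => x i (v f))
    (hv0 : ∀ i, x i (v f) ≠ 0) (hx : ∀ i, proj (x i) ∈ smoothLocus k A)
    (y : ι → Point k A) (hy : ∀ i, y i ∈ smoothLocus k A) :
    ∃ h ∈ SAut k (Suspension f), ∀ i, act h (x i) (v f) = x i (v f) ∧ proj (act h (x i)) = y i := by
  obtain ⟨g, hg, hgx⟩ := exists_move_in_fibers hA (fun i => act (swap k f) (x i))
    (by simpa only [act_swap_u] using hv) (by simpa only [act_swap_u] using hv0)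
    (by simpa only [proj_act_swap] using hx) y hy
  obtain ⟨h, hh, hact⟩ := exists_swap_act hg
  refine ⟨h, hh, fun i => ?_⟩
  rw [hact, act_swap_v, proj_act_swap, (hgx i).1, act_swap_u]
  exact ⟨rfl, (hgx i).2⟩

end Fibers

end Suspension

end AffineVariety

/-! ### Infinite transitivity and flexibility of suspensions -/

namespace AffineVariety

open Polynomial

section Tangent

variable {k : Type*} [Field k] {A : Type*} [CommRing A] [Algebra k A]

theorem GaAction.tangentVector_apply (H : GaAction k A) (x : Point k A) (a : A) :
    (H.tangentVector x).1 a = x ((derivative (H.coact a)).eval 0) := rfl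

/-- At a flexible point, a function with nonzero differential is not critical along some
orbit. -/
theorem IsFlexiblePoint.exists_tangentVector_apply_ne_zero {x : Point k A} (hx : IsFlexiblePoint x)
    {D : tangentSpace x} {a : A} (hD : D.1 a ≠ 0) :
    ∃ H : GaAction k A, (H.tangentVector x).1 a ≠ 0 := by
  by_contra! h
  have key : ∀ E ∈ Submodule.span k (Set.range fun H : GaAction k A => H.tangentVector x),
      E.1 a = 0 := by
    intro E hE
    induction hE using Submodule.span_induction with
    | mem D hD => obtain ⟨H, rfl⟩ := hD; exact h H
    | zero => rfl
    | add D E _ _ h1 h2 =>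
      change D.1 a + E.1 a = 0
      rw [h1, h2, add_zero]
    | smul c D _ h1 =>
      change c * D.1 a = 0
      rw [h1, mul_zero]
  exact hD (key D (by rw [hx]; trivial))

theorem GaAction.congr_tangentVector_apply {B : Type*} [CommRing B] [Algebra k B] (e : A ≃ₐ[k] B)
    (H : GaAction k A) (x : Point k B) (b : B) :
    ((H.congr e).tangentVector x).1 b =
      (H.tangentVector (x.comp (e : A →ₐ[k] B))).1 (e.symm b) := by
  rw [GaAction.tangentVector_apply, GaAction.tangentVector_apply]
  have : (H.congr e).coact b = (H.coact (e.symm b)).map ((e : A →ₐ[k] B) : A →+* B) := rfl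
  rw [this, derivative_map, apply_eval_map, map_zero, eval₂_at_zero, coeff_zero_eq_eval_zero]
  rfl

theorem IsFlexiblePoint.act {x : Point k A} (hx : IsFlexiblePoint x) (g : A ≃ₐ[k] A) :
    IsFlexiblePoint (act g x) := by
  have h := congrArg (Submodule.map (tangentSpaceEquiv g x).toLinearMap) hx
  rw [Submodule.map_span, Submodule.map_top, LinearEquiv.range] at h
  rw [IsFlexiblePoint, eq_top_iff, ← h]
  refine Submodule.span_mono ?_
  rintro _ ⟨_, ⟨H, rfl⟩, rfl⟩
  refine ⟨H.congr g, Subtype.ext (LinearMap.ext fun b => ?_)⟩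
  refine (H.congr_tangentVector_apply g _ b).trans ?_
  have : (AffineVariety.act g x).comp (g : A →ₐ[k] A) = x := by
    ext a
    simp [act_apply]
  rw [this]
  rfl

/-- If a function is not constant on some orbit, it is not critical along the orbit at some point of
it. -/
theorem GaAction.exists_tangentVector_flow_ne_zero [CharZero k] (H : GaAction k A) {x : Point k A}
    {a : A} {t : k} (h : H.flow t x a ≠ x a) : ∃ s, (H.tangentVector (H.flow s x)).1 a ≠ 0 := by
  by_contra! h0
  have hder : ∀ s, (derivative ((H.coact a).map (x : A →+* k))).eval s = 0 := by
    intro s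
    -- The function `t ↦ a ((t + s).x)` has zero derivative at `t = 0`.
    have hpoly : ((H.coact a).map (x : A →+* k)).comp (X + C s) =
        (H.coact a).map (H.flow s x : A →+* k) := by
      refine Polynomial.funext fun t => ?_
      have h1 := H.apply_comorphism x (t + s) a
      have h2 := H.apply_comorphism (H.flow s x) t a
      rw [eval_comp, eval_map, eval_map, ← h2, eval_add, eval_X, eval_C, ← h1]
      exact (DFunLike.congr_fun (H.flow_add t s x) a).symm
    have h3 := congrArg (fun F => (derivative F).eval 0) hpoly
    simp only [derivative_comp, eval_mul, eval_comp] at h3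
    have h4 : (derivative ((H.coact a).map (H.flow s x : A →+* k))).eval 0 =
        (H.tangentVector (H.flow s x)).1 a := by
      rw [derivative_map, GaAction.tangentVector_apply, eval_map, eval₂_at_zero,
        coeff_zero_eq_eval_zero]
      rfl
    rw [h4, h0] at h3
    simpa using h3
  have hconst : derivative ((H.coact a).map (x : A →+* k)) = 0 :=
    Polynomial.funext fun s => by rw [hder s, eval_zero]
  obtain ⟨c, hc⟩ := natDegree_eq_zero.mp (derivative_eq_zero.mp hconst)
  have hflow : ∀ t, H.flow t x a = c := fun t => by
    have := H.apply_comorphism x t a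
    rw [← eval_map, ← hc, eval_C] at this
    exact this
  have h1 := hflow 0
  rw [H.flow_zero] at h1
  exact h ((hflow t).trans h1.symm)

/-- A nonconstant function is not annihilated by the vector fields of all `G_a`-actions if `SAut` is
transitive on the smooth locus. -/
theorem SAutIsTransitive.exists_tangentVector_ne_zero [IsAlgClosed k] [CharZero k] [IsDomain A]
    [Algebra.FiniteType k A] (hA : SAutIsTransitive k A) {f : A}
    (hf : f ∉ Set.range (algebraMap k A)) :
    ∃ (H : GaAction k A) (x : Point k A), (H.tangentVector x).1 f ≠ 0 := by
  by_contra! h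
  have hinv : ∀ g ∈ SAut k A, ∀ x : Point k A, act g x f = x f := by
    intro g hg
    refine SAut_induction (p := fun g => ∀ x : Point k A, act g x f = x f) (fun _ => rfl) ?_ ?_ hg
    · intro H t x
      by_contra hne
      obtain ⟨s, hs⟩ := H.exists_tangentVector_flow_ne_zero hne
      exact hs (h H _)
    · intro g g' hg hg' x
      rw [act_mul, hg, hg']
  obtain ⟨x, hx, y, hy, hxy⟩ := exists_smooth_ne (k := k) hf
  obtain ⟨g, hg, rfl⟩ := hA x hx y hy
  exact hxy (hinv g hg x).symm

end Tangent

namespace Suspension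

variable {k : Type*} [Field k] [IsAlgClosed k] {A : Type*} [CommRing A] [Algebra k A]
  [Algebra.FiniteType k A] [IsDomain A] {f : A} [IsDomain (Suspension f)]

section Transitive

variable [CharZero k]

/-- Where `u ≠ 0`, the points on the fibre can be moved to a point with `v ≠ 0`; at a point with
`u = v = 0`, the differential of `f` is nonzero and the lift of a suitable action moves `v`. -/
theorem exists_act_v_ne_zero (hflex : IsFlexible k A) (hA : SAutIsTransitive k A)
    (hf : f ∉ Set.range (algebraMap k A)) {x : Point k (Suspension f)}
    (hx : x ∈ smoothLocus k (Suspension f)) : ∃ g ∈ SAut k (Suspension f), act g x (v f) ≠ 0 := by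
  obtain ⟨hy, hτ⟩ := smooth_proj hx
  by_cases hv : x (v f) = 0
  · by_cases hu : x (u f) = 0
    · obtain ⟨⟨D, p, q⟩, hD⟩ : ∃ D, tangentEquation x D ≠ 0 := by
        by_contra! h
        exact hτ (LinearMap.ext h)
      have hDf : D.1 f ≠ 0 := by
        intro h0
        apply hD
        change x (u f) * q + x (v f) * p - D.1 f = 0
        rw [hu, hv, h0]
        ring
      obtain ⟨H, hH⟩ := (hflex _ hy).exists_tangentVector_apply_ne_zero hDf
      refine ⟨(liftAction H 1).toAut 1, GaAction.toAut_mem_SAut _ _, ?_⟩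
      rw [GaAction.act_toAut, liftAction_flow_v_of_u_eq_zero _ _ _ hu, hv]
      simpa using hH
    · obtain ⟨y, hy', hyf⟩ := hA.exists_smooth_apply_eq hf 1
      obtain ⟨h, hh, hx'⟩ := exists_move_in_fibers hA (fun _ : Unit => x)
        (Function.injective_of_subsingleton _) (fun _ => hu) (fun _ => hy) (fun _ => y)
        (fun _ => hy')
      refine ⟨h, hh, fun h0 => ?_⟩
      have := apply_u_mul_apply_v (act h x)
      rw [h0, (hx' ()).2, hyf, mul_zero] at this
      exact zero_ne_one this
  · exact ⟨1, one_mem _, hv⟩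

theorem exists_act_u_ne_zero (hflex : IsFlexible k A) (hA : SAutIsTransitive k A)
    (hf : f ∉ Set.range (algebraMap k A)) {x : Point k (Suspension f)}
    (hx : x ∈ smoothLocus k (Suspension f)) : ∃ g ∈ SAut k (Suspension f), act g x (u f) ≠ 0 := by
  obtain ⟨g, hg, h⟩ := exists_act_v_ne_zero hflex hA hf (act_mem_smoothLocus (swap k f) hx)
  obtain ⟨g', hg', hact⟩ := exists_swap_act hg
  exact ⟨g', hg', by rwa [hact, act_swap_u]⟩

theorem exists_act_u_ne_of_act_v_ne (hflex : IsFlexible k A) (hA : SAutIsTransitive k A)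
    (hf : f ∉ Set.range (algebraMap k A)) {x y : Point k (Suspension f)}
    (hx : x ∈ smoothLocus k (Suspension f)) (hy : y ∈ smoothLocus k (Suspension f))
    (h : ∃ g ∈ SAut k (Suspension f), act g x (v f) ≠ act g y (v f)) :
    ∃ g ∈ SAut k (Suspension f), act g x (u f) ≠ act g y (u f) := by
  have hax := isAlgebraicFunction_act x (v f)
  have hay := isAlgebraicFunction_act y (v f)
  obtain ⟨g, hg, hgxy, hgx⟩ := exists_common_ne_zero
    ((hax.sub hay).mul hax) hay
    (by
      obtain ⟨g, hg, h1, h2⟩ := exists_common_ne_zero (hax.sub hay) hax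
        (by obtain ⟨g, hg, h⟩ := h; exact ⟨g, hg, sub_ne_zero.mpr h⟩)
        (exists_act_v_ne_zero hflex hA hf hx)
      exact ⟨g, hg, mul_ne_zero h1 h2⟩)
    (exists_act_v_ne_zero hflex hA hf hy)
  have hvx : act g x (v f) ≠ 0 := right_ne_zero_of_mul hgxy
  have hvxy : act g x (v f) ≠ act g y (v f) := sub_ne_zero.mp (left_ne_zero_of_mul hgxy)
  obtain ⟨x', hx', hx'f⟩ := hA.exists_smooth_apply_eq hf (act g x (v f))
  obtain ⟨y', hy', hy'f⟩ := hA.exists_smooth_apply_eq hf (2 * act g y (v f))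
  obtain ⟨h, hh, hmove⟩ := exists_move_in_fibers' hA ![act g x, act g y]
    (by
      intro i j hij
      fin_cases i <;> fin_cases j <;> simp_all [eq_comm])
    (by simp [Fin.forall_fin_two, hvx, hgx])
    (by
      simp [Fin.forall_fin_two, (smooth_proj (act_mem_smoothLocus g hx)).1,
        (smooth_proj (act_mem_smoothLocus g hy)).1])
    ![x', y'] (by simp [Fin.forall_fin_two, hx', hy'])
  have h0 := hmove 0
  have h1 := hmove 1
  simp only [Matrix.cons_val_zero, Matrix.cons_val_one] at h0 h1
  refine ⟨h * g, mul_mem hh hg, ?_⟩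
  -- The coordinate `u` has been made `1` at the first point and `2` at the second.
  have hu0 : act h (act g x) (u f) = 1 := by
    have := apply_u_mul_apply_v (act h (act g x))
    rw [h0.1, h0.2, hx'f] at this
    exact (mul_eq_right₀ hvx).mp this
  have hu1 : act h (act g y) (u f) = 2 := by
    have := apply_u_mul_apply_v (act h (act g y))
    rw [h1.1, h1.2, hy'f] at this
    exact mul_right_cancel₀ hgx this
  rw [act_mul, act_mul, hu0, hu1]
  norm_num

/-- Two smooth points of the suspension can be moved to points with different coordinate `u`. -/
theorem exists_act_u_ne (hflex : IsFlexible k A) (hA : SAutIsTransitive k A)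
    (hsep : SAutSeparates k A) (hf : f ∉ Set.range (algebraMap k A))
    {x y : Point k (Suspension f)} (hx : x ∈ smoothLocus k (Suspension f))
    (hy : y ∈ smoothLocus k (Suspension f)) (hxy : x ≠ y) :
    ∃ g ∈ SAut k (Suspension f), act g x (u f) ≠ act g y (u f) := by
  obtain ⟨g, hg, hgx, hgy⟩ := exists_common_ne_zero (isAlgebraicFunction_act x (u f))
    (isAlgebraicFunction_act y (u f)) (exists_act_u_ne_zero hflex hA hf hx)
    (exists_act_u_ne_zero hflex hA hf hy)
  by_cases hu : act g x (u f) = act g y (u f)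
  · have hproj : proj (act g x) ≠ proj (act g y) := fun h =>
      hxy (act_injective g (point_ext_of_u_ne_zero h hu hgx))
    obtain ⟨g', hg', hne⟩ := hsep f hf _ (smooth_proj (act_mem_smoothLocus g hx)).1 _
      (smooth_proj (act_mem_smoothLocus g hy)).1 hproj
    obtain ⟨h, hh, h1, h2, -⟩ := exists_lift_fiber (f := f) hg' hgx (S := ∅) (by simp)
    refine exists_act_u_ne_of_act_v_ne hflex hA hf hx hy ⟨h * g, mul_mem hh hg, fun hv => hne ?_⟩
    rw [act_mul, act_mul] at hv
    rw [← h2 _ rfl, ← h2 _ hu.symm, ← apply_u_mul_apply_v, ← apply_u_mul_apply_v, hv, h1, h1, hu]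
  · exact ⟨g, hg, hu⟩

/-- Distinct smooth points of the suspension can be moved to points with distinct and nonzero
coordinates `u`. -/
theorem exists_act_general_position (hflex : IsFlexible k A) (hA : SAutIsTransitive k A)
    (hsep : SAutSeparates k A) (hf : f ∉ Set.range (algebraMap k A)) {ι : Type*} [Finite ι]
    {x : ι → Point k (Suspension f)} (hinj : Function.Injective x)
    (hx : ∀ i, x i ∈ smoothLocus k (Suspension f)) :
    ∃ g ∈ SAut k (Suspension f), Function.Injective (fun i => act g (x i) (u f)) ∧
      ∀ i, act g (x i) (u f) ≠ 0 := by
  classical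
  have := Fintype.ofFinite ι
  have key : ∃ g ∈ SAut k (Suspension f), ∀ p ∈ (Finset.univ : Finset (ι × ι)),
      (if p.1 = p.2 then act g (x p.1) (u f) else act g (x p.1) (u f) - act g (x p.2) (u f)) ≠
        0 := by
    refine exists_forall_ne_zero (c := fun (p : ι × ι) g => if p.1 = p.2 then act g (x p.1) (u f)
      else act g (x p.1) (u f) - act g (x p.2) (u f)) _ ?_ ?_
    · rintro ⟨i, j⟩ -
      by_cases hij : i = j
      · simpa only [hij, if_true] using isAlgebraicFunction_act (x j) (u f)
      · simpa only [hij, if_false] using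
          (isAlgebraicFunction_act (x i) (u f)).sub (isAlgebraicFunction_act (x j) (u f))
    · rintro ⟨i, j⟩ -
      by_cases hij : i = j
      · simpa only [hij, if_true] using exists_act_u_ne_zero hflex hA hf (hx j)
      · simp only [hij, if_false]
        obtain ⟨g, hg, h⟩ := exists_act_u_ne hflex hA hsep hf (hx i) (hx j) (hinj.ne hij)
        exact ⟨g, hg, sub_ne_zero.mpr h⟩
  obtain ⟨g, hg, h⟩ := key
  refine ⟨g, hg, fun i j hij => ?_, fun i => ?_⟩
  · by_contra hne
    have := h (i, j) (Finset.mem_univ _)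
    simp only [hne, if_false] at this
    exact this (sub_eq_zero.mpr hij)
  · simpa using h (i, i) (Finset.mem_univ _)

/-- Moving points with distinct nonzero coordinates `u` inside the fibres of `u`, the coordinates
`v` can be prescribed. -/
theorem exists_act_v_eq (hA : SAutIsTransitive k A) (hf : f ∉ Set.range (algebraMap k A))
    {ι : Type*} [Finite ι] {x : ι → Point k (Suspension f)}
    (hx : ∀ i, proj (x i) ∈ smoothLocus k A) (hu : Function.Injective fun i => x i (u f))
    (hu0 : ∀ i, x i (u f) ≠ 0) (b : ι → k) :
    ∃ g ∈ SAut k (Suspension f), ∀ i, act g (x i) (v f) = b i ∧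
      proj (act g (x i)) ∈ smoothLocus k A := by
  choose y hy hyf using fun i => hA.exists_smooth_apply_eq hf (x i (u f) * b i)
  obtain ⟨g, hg, h⟩ := exists_move_in_fibers hA x hu hu0 hx y hy
  refine ⟨g, hg, fun i => ⟨?_, (h i).2 ▸ hy i⟩⟩
  have := apply_u_mul_apply_v (act g (x i))
  rw [(h i).1, (h i).2, hyf] at this
  exact mul_left_cancel₀ (hu0 i) this

/-- The tuples are moved inside the fibres of `u` to have the same coordinates `v`, and matched by
a motion inside the fibres of `v`. -/
theorem exists_act_eq (hA : SAutIsTransitive k A) (hf : f ∉ Set.range (algebraMap k A)) {m : ℕ}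
    {x y : Fin m → Point k (Suspension f)} (hx : ∀ i, proj (x i) ∈ smoothLocus k A)
    (hux : Function.Injective fun i => x i (u f)) (hux0 : ∀ i, x i (u f) ≠ 0)
    (hy : ∀ i, proj (y i) ∈ smoothLocus k A) (huy : Function.Injective fun i => y i (u f))
    (huy0 : ∀ i, y i (u f) ≠ 0) : ∃ g ∈ SAut k (Suspension f), ∀ i, act g (x i) = y i := by
  let b : Fin m → k := fun i => (((i : ℕ) + 1 : ℕ) : k)
  have hb : Function.Injective b := fun i j hij => by
    have := Nat.cast_injective (R := k) hij
    exact Fin.ext (by omega)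
  have hb0 : ∀ i, b i ≠ 0 := fun i => Nat.cast_ne_zero.mpr (Nat.succ_ne_zero _)
  obtain ⟨g, hg, hgx⟩ := exists_act_v_eq hA hf hx hux hux0 b
  obtain ⟨g', hg', hgy⟩ := exists_act_v_eq hA hf hy huy huy0 b
  obtain ⟨h, hh, hmove⟩ := exists_move_in_fibers' hA (fun i => act g (x i))
    (by simpa only [(hgx _).1] using hb) (by simpa only [(hgx _).1] using hb0)
    (fun i => (hgx i).2) (fun i => proj (act g' (y i))) (fun i => (hgy i).2)
  refine ⟨g'⁻¹ * (h * g), mul_mem (inv_mem hg') (mul_mem hh hg), fun i => ?_⟩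
  have : act h (act g (x i)) = act g' (y i) := by
    have hv : act h (act g (x i)) (v f) = b i := by rw [(hmove i).1, (hgx i).1]
    refine point_ext (hmove i).2 (mul_right_cancel₀ (hb0 i) ?_) (by rw [hv, (hgy i).1])
    rw [← (hgy i).1, apply_u_mul_apply_v, (hgy i).1, ← hv, apply_u_mul_apply_v, (hmove i).2]
  rw [act_mul, act_mul, this, act_inv_act]

theorem sAutIsInfinitelyTransitive (hflex : IsFlexible k A) (hA : SAutIsTransitive k A)
    (hsep : SAutSeparates k A) (hf : f ∉ Set.range (algebraMap k A)) :
    SAutIsInfinitelyTransitive k (Suspension f) := by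
  intro m a b ha hb hareg hbreg
  obtain ⟨g, hg, hga, hga0⟩ := exists_act_general_position hflex hA hsep hf ha hareg
  obtain ⟨g', hg', hgb, hgb0⟩ := exists_act_general_position hflex hA hsep hf hb hbreg
  obtain ⟨h, hh, hact⟩ := exists_act_eq hA hf
    (fun i => (smooth_proj (act_mem_smoothLocus g (hareg i))).1) hga hga0
    (fun i => (smooth_proj (act_mem_smoothLocus g' (hbreg i))).1) hgb hgb0
  refine ⟨g'⁻¹ * (h * g), mul_mem (inv_mem hg') (mul_mem hh hg), fun i => ?_⟩
  rw [act_mul, act_mul, hact, act_inv_act]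

end Transitive

section Flexible

theorem liftAction_tangentVector_base (H : GaAction k A) (x : Point k (Suspension f)) (a : A) :
    ((liftAction H 1).tangentVector x).1 (base k f a) =
      x (u f) * (H.tangentVector (proj x)).1 a := by
  have h : (liftAction (f := f) H 1).coact (base k f a) =
      ((H.coact a).map (base k f : A →+* Suspension f)).comp (C (replica f (1 : k[X])) * X) := by
    rw [← liftCoactBase_apply]
    exact lift_base _ _ _ (u_mul_liftCoactV f H 1) a
  rw [GaAction.tangentVector_apply, h, derivative_comp, derivative_map, eval_mul, eval_comp,
    map_mul, apply_eval_map]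
  simp only [derivative_mul, derivative_C, derivative_X, zero_mul, zero_add, mul_one, eval_C,
    eval_mul, eval_X, mul_zero, map_zero, eval₂_at_zero, coeff_zero_eq_eval_zero, apply_replica,
    eval_one]
  rfl

theorem liftAction_tangentVector_u (H : GaAction k A) (x : Point k (Suspension f)) :
    ((liftAction H 1).tangentVector x).1 (u f) = 0 := by
  have h : (liftAction (f := f) H 1).coact (u f) = C (u f) :=
    lift_u _ _ _ (u_mul_liftCoactV f H 1)
  rw [GaAction.tangentVector_apply, h]
  simp

/-- The lifts of actions with respect to `u` and to `v` span the tangent space where `u v ≠ 0` and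
`f` is not critical. -/
theorem isFlexiblePoint {x : Point k (Suspension f)} (hu : x (u f) ≠ 0) (hv : x (v f) ≠ 0)
    (hy : IsFlexiblePoint (proj x)) {H₀ : GaAction k A}
    (hH₀ : (H₀.tangentVector (proj x)).1 f ≠ 0) : IsFlexiblePoint x := by
  set W := Submodule.span k (Set.range fun H : GaAction k (Suspension f) => H.tangentVector x)
    with hW
  have hWmem : ∀ H : GaAction k (Suspension f), H.tangentVector x ∈ W := fun H =>
    Submodule.subset_span ⟨H, rfl⟩
  have h1 : ∀ D : tangentSpace (proj x), ∃ w ∈ W, (∀ a, w.1 (base k f a) = D.1 a) ∧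
      w.1 (u f) = 0 := by
    intro D
    have hD : D ∈ Submodule.span k
        (Set.range fun H : GaAction k A => H.tangentVector (proj x)) := by
      rw [hy]; trivial
    induction hD using Submodule.span_induction with
    | mem D hD =>
      obtain ⟨H, rfl⟩ := hD
      refine ⟨(x (u f))⁻¹ • (liftAction H 1).tangentVector x, W.smul_mem _ (hWmem _),
        fun a => ?_, ?_⟩
      · change (x (u f))⁻¹ * ((liftAction H 1).tangentVector x).1 (base k f a) = _
        rw [liftAction_tangentVector_base, inv_mul_cancel_left₀ hu]
      · change (x (u f))⁻¹ * ((liftAction H 1).tangentVector x).1 (u f) = _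
        rw [liftAction_tangentVector_u, mul_zero]
    | zero => exact ⟨0, W.zero_mem, fun _ => rfl, rfl⟩
    | add D E _ _ h1 h2 =>
      obtain ⟨w, hw, hwa, hwu⟩ := h1
      obtain ⟨w', hw', hwa', hwu'⟩ := h2
      refine ⟨w + w', W.add_mem hw hw', fun a => ?_, ?_⟩
      · change w.1 _ + w'.1 _ = D.1 a + E.1 a
        rw [hwa, hwa']
      · change w.1 _ + w'.1 _ = 0
        rw [hwu, hwu', add_zero]
    | smul c D _ h1 =>
      obtain ⟨w, hw, hwa, hwu⟩ := h1
      refine ⟨c • w, W.smul_mem c hw, fun a => ?_, ?_⟩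
      · change c * w.1 _ = c * D.1 a
        rw [hwa]
      · change c * w.1 _ = 0
        rw [hwu, mul_zero]
  have h2 : ∃ w ∈ W, w.1 (u f) ≠ 0 := by
    let w := ((liftAction H₀ 1).congr (swap k f)).tangentVector x
    have hcomp : x.comp (swap k f : Suspension f →ₐ[k] Suspension f) = act (swap k f) x := rfl
    have hwv : w.1 (v f) = 0 := by
      refine (GaAction.congr_tangentVector_apply _ _ _ _).trans ?_
      rw [swap_symm, swap_v, liftAction_tangentVector_u]
    have hwb : w.1 (base k f f) = x (v f) * (H₀.tangentVector (proj x)).1 f := by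
      refine (GaAction.congr_tangentVector_apply _ _ _ _).trans ?_
      rw [swap_symm, swap_base, liftAction_tangentVector_base, hcomp, act_swap_u, proj_act_swap]
    refine ⟨w, hWmem _, fun h0 => ?_⟩
    have := tangent_relation w
    rw [hwv, h0, hwb, mul_zero, mul_zero, add_zero] at this
    exact mul_ne_zero hv hH₀ this.symm
  obtain ⟨w, hw, hwu⟩ := h2
  rw [IsFlexiblePoint, eq_top_iff]
  rintro E -
  let E' : tangentSpace x := E - (E.1 (u f) / w.1 (u f)) • w
  have hE' : E'.1 (u f) = 0 := by
    change E.1 (u f) - E.1 (u f) / w.1 (u f) * w.1 (u f) = 0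
    rw [div_mul_cancel₀ _ hwu, sub_self]
  obtain ⟨w', hw', hwb', hwu'⟩ := h1 (tangentMap x E').1
  have hEw : E' = w' := by
    have hb : ∀ a, E'.1 (base k f a) = w'.1 (base k f a) := fun a => (hwb' a).symm
    refine tangentMap_injective x (Prod.ext (Subtype.ext (LinearMap.ext hb)) (Prod.ext ?_ ?_))
    · exact hE'.trans hwu'.symm
    · change E'.1 (v f) = w'.1 (v f)
      have r1 := tangent_relation E'
      have r2 := tangent_relation w'
      rw [hE', mul_zero, add_zero] at r1
      rw [hwu', mul_zero, add_zero, ← hb, ← r1] at r2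
      exact (mul_left_cancel₀ hu r2).symm
  have hE : E = E' + (E.1 (u f) / w.1 (u f)) • w :=
    (sub_add_cancel E ((E.1 (u f) / w.1 (u f)) • w)).symm
  rw [hE, hEw]
  exact W.add_mem hw' (W.smul_mem _ hw)

/-- By transitivity it suffices to find one flexible smooth point. -/
theorem isFlexible [CharZero k] (hflex : IsFlexible k A) (hA : SAutIsTransitive k A)
    (hB : SAutIsTransitive k (Suspension f)) (hf : f ∉ Set.range (algebraMap k A)) :
    IsFlexible k (Suspension f) := by
  obtain ⟨H₀, y, hy⟩ := hA.exists_tangentVector_ne_zero hf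
  have hbase : base k f ((derivative (H₀.coact f)).eval 0) ≠ 0 := by
    intro h
    -- The point `(y, 1, f(y))` of the suspension.
    have := congrArg (lift (f := f) y 1 (y f) (one_mul _)) h
    rw [lift_base, map_zero] at this
    exact hy this
  have hv : v f ≠ 0 := by
    rw [← swap_u k f]
    exact (map_ne_zero_iff _ (swap k f).injective).mpr (u_ne_zero k f)
  obtain ⟨x₀, hx₀, hne⟩ := exists_mem_smoothLocus_apply_ne_zero (k := k)
    (mul_ne_zero (mul_ne_zero (u_ne_zero k f) hv) hbase)
  rw [map_mul, map_mul] at hne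
  have hflex₀ : IsFlexiblePoint x₀ :=
    isFlexiblePoint (left_ne_zero_of_mul (left_ne_zero_of_mul hne))
      (right_ne_zero_of_mul (left_ne_zero_of_mul hne)) (hflex _ (smooth_proj hx₀).1)
      (H₀ := H₀) (right_ne_zero_of_mul hne)
  intro x hx
  obtain ⟨g, -, rfl⟩ := hB x₀ hx₀ x hx
  exact hflex₀.act g

end Flexible

end Suspension

/-! ### The affine line -/

section Line

variable {k : Type*} [Field k]

/-- The action of `G_a` on the affine line by translations. -/
noncomputable def translation (k : Type*) [Field k] : GaAction k k[X] where
  coact := aeval (C X + X)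
  coact_zero a := by
    induction a using Polynomial.induction_on' with
    | add p q hp hq => rw [map_add, eval_add, hp, hq]
    | monomial n c => simp [← C_mul_X_pow_eq_monomial, Polynomial.algebraMap_apply]
  coact_add s t a := by
    induction a using Polynomial.induction_on' with
    | add p q hp hq => simp only [map_add, eval_add, hp, hq]
    | monomial n c =>
      simp only [aeval_monomial, Polynomial.algebraMap_apply, eval_mul, eval_C, eval_pow, eval_add,
        eval_X, map_mul, map_pow, map_add, aeval_C, aeval_X, Algebra.algebraMap_self,
        RingHom.id_apply]
      ring

theorem translation_flow_X (t : k) (x : Point k k[X]) :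
    (translation k).flow t x X = x X + t := by
  rw [GaAction.flow, AlgHom.comp_apply, GaAction.comorphism_apply]
  have hC : x (C t) = t := x.commutes t
  simp [translation, hC]

theorem point_polynomial_apply (x : Point k k[X]) (p : k[X]) : x p = p.eval (x X) := by
  rw [← coe_aeval_eq_eval, aeval_algHom_apply, aeval_X_left_apply]

variable {A : Type*} [CommRing A] [Algebra k A] (e : A ≃ₐ[k] k[X])

/-- The coordinate of a point of a variety isomorphic to the affine line. -/
noncomputable def lineCoord (x : Point k A) : k := x (e.symm X)

theorem apply_eq_eval_lineCoord (x : Point k A) (a : A) : x a = (e a).eval (lineCoord e x) := by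
  have := point_polynomial_apply (x.comp (e.symm : k[X] →ₐ[k] A)) (e a)
  simpa [lineCoord] using this

theorem lineCoord_injective : Function.Injective (lineCoord e) := by
  intro x y h
  ext a
  rw [apply_eq_eval_lineCoord e, apply_eq_eval_lineCoord e y, h]

theorem exists_lineCoord_act_eq (t : k) :
    ∃ g ∈ SAut k A, ∀ x : Point k A, lineCoord e (act g x) = lineCoord e x + t := by
  refine ⟨((translation k).congr e.symm).toAut (-t), GaAction.toAut_mem_SAut _ _, fun x => ?_⟩
  have h := translation_flow_X t (x.comp (e.symm : k[X] →ₐ[k] A))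
  rw [lineCoord, act_apply, GaAction.toAut_symm_apply, neg_neg, GaAction.congr_comorphism]
  simpa [GaAction.flow, lineCoord] using h

theorem sAutIsTransitive_of_line (e : A ≃ₐ[k] k[X]) : SAutIsTransitive k A := by
  intro x _ y _
  obtain ⟨g, hg, h⟩ := exists_lineCoord_act_eq e (lineCoord e y - lineCoord e x)
  exact ⟨g, hg, lineCoord_injective e (by rw [h]; ring)⟩

/-- The reason is that a nonconstant polynomial in characteristic zero has no period. -/
theorem sAutSeparates_of_line [CharZero k] (e : A ≃ₐ[k] k[X]) : SAutSeparates k A := by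
  intro f hf x _ y _ hxy
  by_contra! h
  have hne : lineCoord e x - lineCoord e y ≠ 0 :=
    sub_ne_zero.mpr ((lineCoord_injective e).ne hxy)
  set δ := lineCoord e x - lineCoord e y with hδ
  have hper : ∀ c, (e f).eval (c + δ) = (e f).eval c := by
    intro c
    obtain ⟨g, hg, hact⟩ := exists_lineCoord_act_eq e (c - lineCoord e y)
    have := h g hg
    rw [apply_eq_eval_lineCoord e, apply_eq_eval_lineCoord e (act g y), hact, hact] at this
    convert this using 2 <;> ring
  have hn : ∀ n : ℕ, (e f).eval (n * δ) = (e f).eval 0 := by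
    intro n
    induction n with
    | zero => simp
    | succ n ih => rw [Nat.cast_succ, add_mul, one_mul, hper, ih]
  have hconst : e f = C ((e f).eval 0) := by
    refine Polynomial.eq_of_infinite_eval_eq _ _ (Set.Infinite.mono ?_
      (Set.infinite_range_of_injective (f := fun n : ℕ => (n : k) * δ) ?_))
    · rintro _ ⟨n, rfl⟩
      simp [hn]
    · intro n m hnm
      exact Nat.cast_injective (mul_right_cancel₀ hne hnm)
  refine hf ⟨(e f).eval 0, e.injective ?_⟩
  rw [AlgEquiv.commutes]
  exact hconst.symm

end Line

/-! ### Iterated suspensions -/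

universe u v

/-- Flexibility, transitivity and separation pass from a variety to a suspension over it, which is
even infinitely transitive; so these three properties carry the induction, with the affine line
allowed as a start. -/
theorem IsIteratedSuspension.flexible_and_transitive {k : Type u} [Field k] [IsAlgClosed k]
    [CharZero k] {A : Type v} [CommRing A] [IsDomain A] [Algebra k A] [Algebra.FiniteType k A]
    (hflex : IsFlexible k A) (hA : SAutIsTransitive k A) (hsep : SAutSeparates k A) {l : ℕ}
    {B : Type v} [CommRing B] [Algebra k B] (hB : IsIteratedSuspension k A l B) :
    (IsDomain B ∧ Algebra.FiniteType k B ∧ IsFlexible k B ∧ SAutIsTransitive k B ∧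
      SAutSeparates k B) ∧ (1 ≤ l → SAutIsInfinitelyTransitive k B) := by
  induction hB with
  | zero => exact ⟨⟨‹_›, ‹_›, hflex, hA, hsep⟩, fun h => absurd h (by norm_num)⟩
  | succ f hf hB ih =>
    obtain ⟨⟨hdom, hft, hflexB, htrans, hsepB⟩, -⟩ := ih
    have hf0 : f ≠ 0 := fun h => hf ⟨0, by rw [map_zero, h]⟩
    have := Suspension.isDomain k f hf0
    have hinf := Suspension.sAutIsInfinitelyTransitive hflexB htrans hsepB hf
    exact ⟨⟨this, inferInstance, Suspension.isFlexible hflexB htrans hinf.transitive hf,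
      hinf.transitive, hinf.separates⟩, fun _ => hinf⟩

end AffineVariety

theorem mainTheorem3 {k : Type*} [Field k] [IsAlgClosed k] [CharZero k]
    {A : Type*} [CommRing A] [IsDomain A] [Algebra k A] [Algebra.FiniteType k A]
    (hflex : AffineVariety.IsFlexible k A)
    (hA : Nonempty (A ≃ₐ[k] Polynomial k) ∨
      (2 ≤ ringKrullDim A ∧ AffineVariety.SAutIsInfinitelyTransitive k A))
    (l : ℕ) (hl : 1 ≤ l) {B : Type _} [CommRing B] [Algebra k B]
    (hB : AffineVariety.IsIteratedSuspension k A l B) :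
    AffineVariety.IsFlexible k B ∧ AffineVariety.SAutIsInfinitelyTransitive k B := by
  obtain ⟨htrans, hsep⟩ : AffineVariety.SAutIsTransitive k A ∧ AffineVariety.SAutSeparates k A := by
    rcases hA with ⟨⟨e⟩⟩ | ⟨-, hinf⟩
    · exact ⟨AffineVariety.sAutIsTransitive_of_line e, AffineVariety.sAutSeparates_of_line e⟩
    · exact ⟨hinf.transitive, hinf.separates⟩
  obtain ⟨⟨-, -, h, -⟩, hinf⟩ := hB.flexible_and_transitive hflex htrans hsep
  exact ⟨h, hinf hl⟩
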